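/- **Conventions.** A Banach function space $\mathrm E$ over $(0,\infty)$ is a Banach space of (classes of) complex measurable functions on $(0,\infty)$ with $L^1\cap L^\infty\subseteq \mathrm E\subseteq L^1+L^\infty$ which is an order ideal: if $f\in \mathrm E$, $g\in L^1+L^\infty$ and $|g|\le |f|$ a.e., then $g\in \mathrm E$ and $\|g\|_{\mathrm E}\le\|f\|_{\mathrm E}$. We put $\|f\|_{\mathrm E}=\infty$ if $f\notin \mathrm E$. The Hardy operator is $Pf(t)=\frac1t\int_0^t f(s)\,ds$. Let $X$ be a Banach space. A relation $A\subseteq X\times X$ with domain $D(A)$ is $m$-accretive of type $\omega$ if for every $\lambda>0$ with $\lambda\omega<1$ one has $\|x-\hat x+\lambda(f-\hat f)\|\ge(1-\lambda\omega)\|x-\hat x\|$ for all $(x,f),(\hat x,\hat f)\in A$, and $I+\lambda A$ is surjective onto $X$. Put $|Ax|=\inf\{\|f\| : f\in Ax\}$ ($=\infty$ if $x\notin D(A)$). For $t>0$ let $K(x,t)=\inf_{v\in X}\left(\|x-v\|+t\,|Av|\right)$, and for $\tau>0$ let $$(\mathcal N^A)^\tau_{\mathrm E}(x)=\left\| t\mapsto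 \tfrac{K(x,t)}{t}\,\chi_{(0,\tau)}(t)\right\|_{\mathrm E}\in[0,\infty],$$ with effective domain $\{x : (\mathcal N^A)^\tau_{\mathrm E}(x)<\infty\}$. The semigroup $S$ generated by $-A$ is $S(t)x=u(t)$ for $t\ge0$ and $x\in\overline{D(A)}$, where $u$ is the mild solution of $\dot u+Au\ni0$, $u(0)=x$, that is, $u$ is continuous on $[0,\infty)$ with $u(0)=x$ and on every $[0,T]$ it is a uniform limit of $\varepsilon$-approximate solutions of the implicit Euler scheme. **Theorem (Hölder type estimate).** Let $A$ be an $m$-accretive operator of type $\omega\ge0$ on a Banach space $X$, let $S$ be the semigroup generated by $-A$ (for every $x\in\overline{D(A)}$ the orbit $S(\cdot)x$ is indeed a mild solution), and let $\tau>0$ with $\tau\omega<1$. 1. Let $\mathrm E$ be a Banach function space over $(0,\infty)$ on which the Hardy operator is bounded, and let $x$ lie in the effective domain of $(\mathcal N^A)^\tau_{\mathrm E}$. Then $x\in\overline{D(A)}$, and for all $T>0$, $t\in[0,T]$ and $h\in(0,\tau)$, $$\|S(t+h)x-S(t)x\|\le e^{\omega T}\,(1+e^{\omega\tau})\,(\mathcal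 N^A)^\tau_{\mathrm E}(x)\,\frac{h}{\|\chi_{(0,h)}\|_{\mathrm E}} .$$ 2. Let $\theta\in(0,1)$ and $p\in[1,\infty)$. The same holds with $\mathrm E$ replaced by the weighted space $\mathrm E_{\theta,p}=L^p(0,\infty;t^{p(1-\theta)-1}\,dt)$. Moreover, for $x$ in the effective domain of $(\mathcal N^A)^\tau_{\mathrm E_{\theta,p}}$ the orbit $S(\cdot)x$ is locally Hölder continuous of exponent $\theta$: for every $T>0$ there is $C$ with $\|S(t)x-S(s)x\|\le C|t-s|^\theta$ for all $s,t\in[0,T]$. -/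

import Mathlib

open Set Filter Topology MeasureTheory
open scoped ENNReal

noncomputable section

namespace HolderSemigroup

/-! ### Banach function spaces over the half-line -/

/-- Lebesgue measure on `(0, ∞)`. -/
abbrev halfLine : Measure ℝ := volume.restrict (Ioi 0)

/-- A Banach function space over `(0, ∞)`: a linear space of (classes of) complex measurable
functions with a complete norm, lying between `L¹ ∩ L^∞` and `L¹ + L^∞`, which is an order ideal
of `L¹ + L^∞`. -/
structure BanachFunctionSpace where
  /-- the space, as a linear subspace of the space of classes of measurable functions -/
  carrier : Submodule ℂ (ℝ →ₘ[halfLine] ℂ)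
  /-- the norm of the space -/
  nrm : Seminorm ℂ carrier
  nrm_definite : ∀ f : carrier, nrm f = 0 → f = 0
  complete : ∀ u : ℕ → carrier,
    (∀ ε > 0, ∃ n₀, ∀ m ≥ n₀, ∀ n ≥ n₀, nrm (u m - u n) < ε) →
      ∃ f : carrier, Tendsto (fun n => nrm (u n - f)) atTop (𝓝 0)
  inf_le : Lp ℂ 1 halfLine ⊓ Lp ℂ ∞ halfLine ≤ carrier.toAddSubgroup
  le_sup : carrier.toAddSubgroup ≤ Lp ℂ 1 halfLine ⊔ Lp ℂ ∞ halfLine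
  ideal : ∀ f : carrier, ∀ g ∈ Lp ℂ 1 halfLine ⊔ Lp ℂ ∞ halfLine,
    (∀ᵐ t ∂halfLine, ‖g t‖ ≤ ‖(f : ℝ →ₘ[halfLine] ℂ) t‖) →
      ∃ hg : g ∈ carrier, nrm ⟨g, hg⟩ ≤ nrm f

/-- The norm in `E` of a function with values in `[0, ∞]`; it is `∞` if the function is not in `E`.
All elements of `E` with the same absolute value have the same norm by the ideal property, so the
infimum is over at most one value. -/
def BanachFunctionSpace.eNorm (E : BanachFunctionSpace) (f : ℝ → ℝ≥0∞) : ℝ≥0∞ :=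
  ⨅ (g : E.carrier) (_ : ∀ᵐ t ∂halfLine, ‖(g : ℝ →ₘ[halfLine] ℂ) t‖ₑ = f t),
    ENNReal.ofReal (E.nrm g)

/-- The Hardy operator `P f (t) = (1 / t) ∫₀ᵗ f` maps `E` boundedly into `E`. -/
def BanachFunctionSpace.HardyBounded (E : BanachFunctionSpace) : Prop :=
  ∃ C : ℝ, ∀ f : E.carrier, ∃ g : E.carrier,
    (∀ᵐ t ∂halfLine, (g : ℝ →ₘ[halfLine] ℂ) t
        = (t : ℂ)⁻¹ * ∫ s in (0 : ℝ)..t, (f : ℝ →ₘ[halfLine] ℂ) s) ∧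
      E.nrm g ≤ C * E.nrm f

/-- The norm of `L^p(0, ∞; t^{p(1-θ)-1} dt)`, on functions with values in `[0, ∞]`. -/
def weightedNorm (θ p : ℝ) (f : ℝ → ℝ≥0∞) : ℝ≥0∞ :=
  (∫⁻ t in Ioi (0 : ℝ), f t ^ p * ENNReal.ofReal (t ^ (p * (1 - θ) - 1))) ^ (1 / p)

/-! ### The `K`-method for functions -/

section Interpolation

variable {X : Type*} [AddCommGroup X]

/-- The `K`-function of the couple `(N₀, N₁)`. -/
def kFun (N₀ N₁ : X → ℝ≥0∞) (x : X) (t : ℝ) : ℝ≥0∞ :=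
  ⨅ v : X, N₀ (x - v) + ENNReal.ofReal t * N₁ v

/-- The finite interpolation function `‖ t ↦ K(x, t) / t · χ_{(0, τ)}(t) ‖` of the couple
`(N₀, N₁)`, for the function norm `nrm`. -/
def interpFun (nrm : (ℝ → ℝ≥0∞) → ℝ≥0∞) (N₀ N₁ : X → ℝ≥0∞) (τ : ℝ) (x : X) : ℝ≥0∞ :=
  nrm ((Ioo 0 τ).indicator fun t => kFun N₀ N₁ x t / ENNReal.ofReal t)

end Interpolation

/-- The characteristic function of `(0, h)`. -/
def chi (h : ℝ) : ℝ → ℝ≥0∞ := (Ioo 0 h).indicator 1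

/-! ### Accretive operators and their semigroups -/

section Operators

variable {X : Type*} [NormedAddCommGroup X]

/-- The domain of a multivalued operator. -/
def dom (A : Set (X × X)) : Set X := {x | ∃ f, (x, f) ∈ A}

/-- The set norm `|A x| = inf {‖f‖ : f ∈ A x}`, equal to `∞` outside of the domain. -/
def setNorm (A : Set (X × X)) (x : X) : ℝ≥0∞ := ⨅ (f : X) (_ : (x, f) ∈ A), ‖f‖ₑ

/-- The finite interpolation function of the couple `(‖·‖, |A ·|)`. -/
def interpOp (nrm : (ℝ → ℝ≥0∞) → ℝ≥0∞) (A : Set (X × X)) (τ : ℝ) (x : X) : ℝ≥0∞ :=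
  interpFun nrm (fun y => ‖y‖ₑ) (setNorm A) τ x

variable [NormedSpace ℝ X]

/-- `A` is `m`-accretive of type `ω`. -/
structure IsMAccretive (A : Set (X × X)) (ω : ℝ) : Prop where
  accretive : ∀ x f y g, (x, f) ∈ A → (y, g) ∈ A → ∀ l : ℝ, 0 < l → l * ω < 1 →
    (1 - l * ω) * ‖x - y‖ ≤ ‖x - y + l • (f - g)‖
  surjective : ∀ l : ℝ, 0 < l → l * ω < 1 → ∀ y, ∃ x f, (x, f) ∈ A ∧ x + l • f = y

/-- An `ε`-approximate solution on `[0, T]` of `u' + A u ∋ 0`: nodes `0 = t 0 < ⋯ < t n`, values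
`z i` and errors `e i` which satisfy the implicit Euler scheme
`(z (i+1) - z i) / (t (i+1) - t i) + A (z (i+1)) ∋ e i`. -/
structure IsApproxSolution (A : Set (X × X)) (ε T : ℝ) (n : ℕ) (t : ℕ → ℝ) (z e : ℕ → X) :
    Prop where
  start : t 0 = 0
  step_pos : ∀ i < n, t i < t (i + 1)
  step_lt : ∀ i < n, t (i + 1) - t i < ε
  lt_last : T - ε < t n
  last_le : t n ≤ T
  error : ∑ i ∈ Finset.range n, (t (i + 1) - t i) * ‖e i‖ < ε
  scheme : ∀ i < n, (z (i + 1), e i - (t (i + 1) - t i)⁻¹ • (z (i + 1) - z i)) ∈ A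

/-- `u : [0, ∞) → X` is a mild solution of `u' + A u ∋ 0`, `u(0) = x`: it is continuous and, on each
`[0, T]`, a uniform limit of piecewise constant functions that come from approximate solutions
(with value `z 0` at `0` and `z (i + 1)` on `(t i, t (i + 1)]`). -/
structure IsMildSolution (A : Set (X × X)) (x : X) (u : ℝ → X) : Prop where
  continuousOn : ContinuousOn u (Ici 0)
  initial : u 0 = x
  approx : ∀ T > 0, ∀ ε > 0, ∃ n t z e, IsApproxSolution A ε T n t z e ∧
    ‖u 0 - z 0‖ ≤ ε ∧ ∀ i < n, ∀ s ∈ Ioc (t i) (t (i + 1)), ‖u s - z (i + 1)‖ ≤ ε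

open Classical in
/-- The semigroup generated by `-A`: `S(t) x = u(t)` for `t ≥ 0`, where `u` is the mild solution of
`u' + A u ∋ 0`, `u(0) = x`. Points from which no mild solution starts are left fixed. -/
def semigroup (A : Set (X × X)) (t : ℝ) (x : X) : X :=
  if hx : ∃ u, IsMildSolution A x u then hx.choose t else x

end Operators

end HolderSemigroup

end

noncomputable section

namespace HolderSemigroup

/-! ### A comparison principle for a recursion on a grid -/

/-! The exponent comes from comparing the orbit with constants. If `(v, b) ∈ A`, then `v` is a
stationary point up to the forcing `b`, so accretivity gives `‖S(h)x - v‖ ≤ e^{ωh} (‖x - v‖ +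
h‖b‖)`. Adding `‖x - v‖` and minimizing over `(v, b)` gives `‖S(h)x - x‖ ≤ (1 + e^{ωh}) K(x, h)`.
Since `K(x, t) / t` decreases in `t`, the function defining the interpolation norm dominates `K(x,
h) / h` on `(0, h)`. Hence `K(x, h)` is at most that norm times `h / ‖χ_{(0,h)}‖`. These two facts
are `norm_semigroup_sub_self_le` and `kOp_div_anti`, and `norm_semigroup_add_sub_le_of_kOp` joins
them.

To pass from time `0` to time `t`, no semigroup law is needed. The translate `S(h + ·)x` is again a
mild solution, and it is compared with `S(·)x` through continuous dependence, which costs `e^{ωt}`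
(`IsMildSolution.translate`, `IsMildSolution.norm_sub_le`).

Continuous dependence and existence both rest on Kobayashi's estimate for two Euler schemes on
different grids. The resolvent inequality gives a discrete transport recursion for `‖z i - y j‖`,
and an explicit solution of the recursion dominates the boundary values (`le_barrier`, `two_step`,
`norm_sub_le_schemeBound`). Kobayashi's square root is replaced by the quadratic AM-GM majorant with
parameter `η`; this solves the recursion exactly, and `η → 0` is taken after the mesh tends to zero.
-/

lemma le_half_sq_div_add {s V η : ℝ} (hV : 0 ≤ V) (hη : 0 < η) :
    s ≤ ((s ^ 2 + V) / η + η) / 2 := by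
  have h : 2 * s - η ≤ (s ^ 2 + V) / η := by
    rw [le_div_iff₀ hη]
    nlinarith [sq_nonneg (s - η)]
  linarith

/-- A double sequence which satisfies the recursion of Kobayashi's argument is bounded by an explicit
solution of the recursion that dominates the boundary values. -/
lemma le_barrier {n m : ℕ} {c : ℕ → ℕ → ℝ} {γ δ ε φ : ℕ → ℝ} {B K η : ℝ}
    (hγ : ∀ i < n, 0 < γ i) (hδ : ∀ j < m, 0 < δ j) (hK : 0 ≤ K) (hη : 0 < η)
    (h0 : ∀ i ≤ n, c i 0 ≤ B + ∑ k ∈ Finset.range i, γ k * ε k + K * ∑ k ∈ Finset.range i, γ k)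
    (h1 : ∀ j ≤ m, c 0 j ≤ B + ∑ k ∈ Finset.range j, δ k * φ k + K * ∑ k ∈ Finset.range j, δ k)
    (hc : ∀ i < n, ∀ j < m, (γ i + δ j) * c (i + 1) (j + 1)
      ≤ γ i * c (i + 1) j + δ j * c i (j + 1) + γ i * δ j * (ε i + φ j)) :
    ∀ i ≤ n, ∀ j ≤ m, c i j ≤ B + ∑ k ∈ Finset.range i, γ k * ε k
      + ∑ k ∈ Finset.range j, δ k * φ k
      + K * ((((∑ k ∈ Finset.range i, γ k - ∑ k ∈ Finset.range j, δ k) ^ 2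
        + (∑ k ∈ Finset.range i, γ k ^ 2 + ∑ k ∈ Finset.range j, δ k ^ 2)) / η + η) / 2) := by
  intro i
  induction i with
  | zero =>
    -- On the boundary of the grid the linear growth `K s` lies below the quadratic barrier by
    -- AM-GM; the variance term only helps.
    intro _ j hj
    refine (h1 j hj).trans ?_
    have := le_half_sq_div_add (s := ∑ k ∈ Finset.range j, δ k)
      (Finset.sum_nonneg fun k _ => sq_nonneg (δ k) : 0 ≤ ∑ k ∈ Finset.range j, δ k ^ 2) hη
    simpa using mul_le_mul_of_nonneg_left this hK
  | succ i ihi =>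
    intro hi j
    induction j with
    | zero =>
      intro _
      refine (h0 (i + 1) hi).trans ?_
      have := le_half_sq_div_add (s := ∑ k ∈ Finset.range (i + 1), γ k)
        (Finset.sum_nonneg fun k _ => sq_nonneg (γ k) :
          0 ≤ ∑ k ∈ Finset.range (i + 1), γ k ^ 2) hη
      simpa using mul_le_mul_of_nonneg_left this hK
    | succ j ihj =>
      intro hj
      have a1 := ihi (by omega) (j + 1) hj
      have a2 := ihj (by omega)
      have a3 := hc i (by omega) j (by omega)
      have gp := hγ i (by omega)
      have dp := hδ j (by omega)
      have hp : 0 < γ i + δ j := by linarith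
      refine le_of_mul_le_mul_left ?_ hp
      refine a3.trans ?_
      have b1 := mul_le_mul_of_nonneg_left a1 dp.le
      have b2 := mul_le_mul_of_nonneg_left a2 gp.le
      -- Each part of the barrier satisfies the recursion with equality. For the quadratic part,
      -- with `σ` the difference of the partial sums, this is `(γ + δ)((σ + γ - δ)² + γ² + δ²) =
      -- γ((σ + γ)² + γ²) + δ((σ - δ)² + δ²)`.
      refine (add_le_add_left (add_le_add b2 b1) _).trans (le_of_eq ?_)
      simp only [Finset.sum_range_succ]
      field_simp
      ring

/-! ### Estimates for the implicit Euler scheme -/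

section Scheme

variable {X : Type*} [NormedAddCommGroup X] [NormedSpace ℝ X] {A : Set (X × X)} {ω : ℝ}

/-- The weight `∏ (1 - ω γ)⁻¹` of the implicit Euler scheme with nodes `t`. -/
def weight (ω : ℝ) (t : ℕ → ℝ) (i : ℕ) : ℝ :=
  ∏ k ∈ Finset.range i, (1 - ω * (t (k + 1) - t k))⁻¹

namespace IsApproxSolution

variable {ε T : ℝ} {n : ℕ} {t : ℕ → ℝ} {z e : ℕ → X}

lemma eps_pos (h : IsApproxSolution A ε T n t z e) : 0 < ε := by
  have h1 := h.lt_last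
  have h2 := h.last_le
  linarith

lemma mono (h : IsApproxSolution A ε T n t z e) {ε' : ℝ} (hε : ε ≤ ε') :
    IsApproxSolution A ε' T n t z e where
  start := h.start
  step_pos := h.step_pos
  step_lt i hi := (h.step_lt i hi).trans_le hε
  lt_last := by linarith [h.lt_last]
  last_le := h.last_le
  error := h.error.trans_le hε
  scheme := h.scheme

lemma node_le (h : IsApproxSolution A ε T n t z e) {i j : ℕ} (hij : i ≤ j) (hj : j ≤ n) :
    t i ≤ t j := by
  induction j, hij using Nat.le_induction with
  | base => exact le_rfl
  | succ j _ ih => exact (ih (by omega)).trans (h.step_pos j (by omega)).le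

lemma node_nonneg (h : IsApproxSolution A ε T n t z e) {i : ℕ} (hi : i ≤ n) : 0 ≤ t i :=
  h.start ▸ h.node_le (Nat.zero_le i) hi

lemma node_le_last (h : IsApproxSolution A ε T n t z e) {i : ℕ} (hi : i ≤ n) : t i ≤ T :=
  (h.node_le hi le_rfl).trans h.last_le

lemma sum_steps (h : IsApproxSolution A ε T n t z e) (i : ℕ) :
    ∑ k ∈ Finset.range i, (t (k + 1) - t k) = t i := by
  rw [Finset.sum_range_sub, h.start, sub_zero]

/-- Every positive time up to the last node lies in one of the intervals of the scheme. -/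
lemma exists_mem_Ioc (h : IsApproxSolution A ε T n t z e) {s : ℝ} (hs : 0 < s) (hs' : s ≤ t n) :
    ∃ i < n, s ∈ Ioc (t i) (t (i + 1)) := by
  classical
  have hex : ∃ i, s ≤ t i := ⟨n, hs'⟩
  have h0 : Nat.find hex ≠ 0 := by
    intro h0
    have := Nat.find_spec hex
    rw [h0, h.start] at this
    linarith
  obtain ⟨i, hi⟩ := Nat.exists_eq_succ_of_ne_zero h0
  have hle : Nat.find hex ≤ n := Nat.find_min' hex hs'
  refine ⟨i, by omega, ?_, ?_⟩
  · have := Nat.find_min hex (m := i) (by omega)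
    exact not_le.1 this
  · have := Nat.find_spec hex
    rwa [hi] at this

lemma factor_pos (h : IsApproxSolution A ε T n t z e) (hω : 0 ≤ ω) (hε : ω * ε < 1)
    {k : ℕ} (hk : k < n) : 1 - ω * ε ≤ 1 - ω * (t (k + 1) - t k) ∧
      0 < 1 - ω * (t (k + 1) - t k) ∧ 1 - ω * (t (k + 1) - t k) ≤ 1 := by
  have h1 := mul_le_mul_of_nonneg_left (h.step_lt k hk).le hω
  have h2 := mul_nonneg hω (sub_pos.2 (h.step_pos k hk)).le
  refine ⟨?_, ?_, ?_⟩ <;> linarith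

lemma one_le_weight (h : IsApproxSolution A ε T n t z e) (hω : 0 ≤ ω) (hε : ω * ε < 1)
    {i : ℕ} (hi : i ≤ n) : 1 ≤ weight ω t i := by
  induction i with
  | zero => simp [weight]
  | succ i ih =>
    obtain ⟨_, h2, h3⟩ := h.factor_pos hω hε (k := i) (by omega)
    rw [weight, Finset.prod_range_succ]
    exact one_le_mul_of_one_le_of_one_le (ih (by omega)) ((one_le_inv₀ h2).2 h3)

lemma weight_le_exp (h : IsApproxSolution A ε T n t z e) (hω : 0 ≤ ω) (hε : ω * ε < 1)
    {i : ℕ} (hi : i ≤ n) : weight ω t i ≤ Real.exp ((1 - ω * ε)⁻¹ * ω * t i) := by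
  have hpos : 0 < 1 - ω * ε := by linarith
  induction i with
  | zero => simp [weight, h.start]
  | succ i ih =>
    obtain ⟨h1, h2, h3⟩ := h.factor_pos hω hε (k := i) (by omega)
    have hg := h.step_pos i (by omega)
    rw [weight, Finset.prod_range_succ]
    -- With `q = ω * (t (i + 1) - t i)`, one has `1 / (1 - q) = 1 + q / (1 - q)`, and `1 / (1 - q)`
    -- is at most the uniform constant `(1 - ω * ε)⁻¹`.
    have key : (1 - ω * (t (i + 1) - t i))⁻¹
        ≤ Real.exp ((1 - ω * ε)⁻¹ * ω * (t (i + 1) - t i)) := by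
      refine le_trans ?_ (Real.add_one_le_exp _)
      have e1 : (1 - ω * (t (i + 1) - t i))⁻¹
          = (1 - ω * (t (i + 1) - t i))⁻¹ * (ω * (t (i + 1) - t i)) + 1 := by
        field_simp
        ring
      rw [e1, mul_assoc]
      have : 0 ≤ ω * (t (i + 1) - t i) := by linarith
      gcongr
    calc _ ≤ Real.exp ((1 - ω * ε)⁻¹ * ω * t i)
          * Real.exp ((1 - ω * ε)⁻¹ * ω * (t (i + 1) - t i)) :=
          mul_le_mul (ih (by omega)) key (inv_nonneg.2 h2.le) (Real.exp_pos _).le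
      _ = _ := by rw [← Real.exp_add]; congr 1; ring

lemma weight_succ (h : IsApproxSolution A ε T n t z e) (hω : 0 ≤ ω) (hε : ω * ε < 1)
    {i : ℕ} (hi : i < n) :
    (1 - ω * (t (i + 1) - t i)) * weight ω t (i + 1) = weight ω t i := by
  have := (h.factor_pos hω hε hi).2.1
  rw [weight, weight, Finset.prod_range_succ]
  field_simp

/-- Distance of an approximate solution to a point of the domain. -/
lemma norm_sub_dom_le (h : IsApproxSolution A ε T n t z e) (hA : IsMAccretive A ω)
    (hω : 0 ≤ ω) (hε : ω * ε < 1) {a b : X} (hab : (a, b) ∈ A) {i : ℕ} (hi : i ≤ n) :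
    ‖z i - a‖ ≤ weight ω t i * (‖z 0 - a‖
      + ∑ k ∈ Finset.range i, (t (k + 1) - t k) * ‖e k‖ + t i * ‖b‖) := by
  induction i with
  | zero => simp [weight, h.start]
  | succ i ih =>
    obtain ⟨h1, h2, h3⟩ := h.factor_pos hω hε (k := i) (by omega)
    have hg := h.step_pos i (by omega)
    have hw := h.one_le_weight hω hε (i := i) (by omega)
    have hacc := hA.accretive _ _ _ _ (h.scheme i (by omega)) hab (t (i + 1) - t i)
      (by linarith) (by linarith)
    -- Taking the resolvent parameter equal to the step cancels `z (i + 1)` and leaves only the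
    -- previous value.
    have e1 : z (i + 1) - a + (t (i + 1) - t i) •
        (e i - (t (i + 1) - t i)⁻¹ • (z (i + 1) - z i) - b)
        = (z i - a) + (t (i + 1) - t i) • (e i - b) := by
      simp only [smul_sub, smul_smul]
      rw [mul_inv_cancel₀ (sub_pos.2 hg).ne', one_smul, one_smul]
      abel
    rw [e1] at hacc
    have e2 : ‖(z i - a) + (t (i + 1) - t i) • (e i - b)‖
        ≤ ‖z i - a‖ + (t (i + 1) - t i) * (‖e i‖ + ‖b‖) := by
      refine (norm_add_le _ _).trans ?_
      rw [norm_smul, Real.norm_of_nonneg (by linarith)]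
      gcongr
      exact norm_sub_le _ _
    refine le_of_mul_le_mul_left ?_ h2
    rw [← mul_assoc, h.weight_succ hω hε (by omega), Finset.sum_range_succ]
    rw [mul_comm _ ω] at hacc
    have e3 : (t (i + 1) - t i) * (‖e i‖ + ‖b‖)
        ≤ weight ω t i * ((t (i + 1) - t i) * (‖e i‖ + ‖b‖)) := by
      refine le_mul_of_one_le_left ?_ hw
      have := sub_pos.2 hg
      positivity
    have := ih (by omega)
    linarith

end IsApproxSolution
end Scheme

/-! ### Comparison of two Euler schemes on different grids. -/

section Scheme
variable {X : Type*} [NormedAddCommGroup X] [NormedSpace ℝ X] {A : Set (X × X)} {ω : ℝ}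

/-- The resolvent inequality that two steps of the implicit Euler scheme satisfy. -/
lemma IsMAccretive.two_step (hA : IsMAccretive A ω) (hω : 0 ≤ ω) {γ δ : ℝ} (hγ : 0 < γ) (hδ : 0 < δ)
    (hγω : ω * γ < 1) {x x' e y y' f : X} (hx : (x, e - γ⁻¹ • (x - x')) ∈ A)
    (hy : (y, f - δ⁻¹ • (y - y')) ∈ A) :
    (γ + δ - ω * (γ * δ)) * ‖x - y‖ ≤ γ * ‖x - y'‖ + δ * ‖x' - y‖ + γ * δ * (‖e‖ + ‖f‖) := by
  have hs : 0 < γ + δ := by linarith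
  -- This parameter makes `(γ + δ) l γ⁻¹ = δ` and `(γ + δ) l δ⁻¹ = γ`, so the differences recombine
  -- into `x - y'` and `x' - y`. As `l ≤ γ`, smallness of `γ` alone makes it admissible.
  set l := γ * δ / (γ + δ) with hl
  have hl0 : 0 < l := by positivity
  have hlγ : l ≤ γ := by
    rw [hl, div_le_iff₀ hs]
    nlinarith
  have hlω : l * ω < 1 := by
    rw [mul_comm]
    exact (mul_le_mul_of_nonneg_left hlγ hω).trans_lt hγω
  have h := hA.accretive _ _ _ _ hx hy l hl0 hlω
  have e1 : (γ + δ) • (x - y + l • (e - γ⁻¹ • (x - x') - (f - δ⁻¹ • (y - y'))))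
      = γ • (x - y') + δ • (x' - y) + (γ * δ) • (e - f) := by
    have c0 : (γ + δ) * l = γ * δ := by rw [hl]; field_simp
    have c1 : (γ * δ) * γ⁻¹ = δ := by field_simp
    have c2 : (γ * δ) * δ⁻¹ = γ := by field_simp
    simp only [smul_add, smul_sub, smul_smul, ← mul_assoc, c0, c1, c2]
    rw [add_smul, add_smul]
    abel
  have e2 : (γ + δ) * ‖x - y + l • (e - γ⁻¹ • (x - x') - (f - δ⁻¹ • (y - y')))‖
      ≤ γ * ‖x - y'‖ + δ * ‖x' - y‖ + γ * δ * (‖e‖ + ‖f‖) := by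
    rw [← Real.norm_of_nonneg hs.le, ← norm_smul, e1]
    refine (norm_add₃_le).trans ?_
    rw [norm_smul, norm_smul, norm_smul, Real.norm_of_nonneg hγ.le, Real.norm_of_nonneg hδ.le,
      Real.norm_of_nonneg (by positivity)]
    gcongr
    exact norm_sub_le _ _
  refine le_trans (le_of_eq ?_) ((mul_le_mul_of_nonneg_left h hs.le).trans e2)
  rw [hl]
  field_simp

/-- The right hand side of the estimate for the distance of two approximate solutions. -/
def schemeBound (ω T r₀ r₁ b η s ε d : ℝ) : ℝ :=
  Real.exp ((1 - ω * ε)⁻¹ * ω * s) * (r₀ + Real.exp ((1 - ω * ε)⁻¹ * ω * T) * r₁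
    + (1 - ω * ε)⁻¹ * ε + Real.exp ((1 - ω * ε)⁻¹ * ω * T) * ε
    + Real.exp ((1 - ω * ε)⁻¹ * ω * T) * b
      * (((d + ((1 - ω * ε)⁻¹ - 1) * T) ^ 2
        + ((1 - ω * ε)⁻¹ ^ 2 * ε * T + ε * T)) / η + η) / 2)

lemma IsApproxSolution.sum_error_le {ε T : ℝ} {n : ℕ} {t : ℕ → ℝ} {z e : ℕ → X}
    (h : IsApproxSolution A ε T n t z e) {i : ℕ} (hi : i ≤ n) :
    ∑ k ∈ Finset.range i, (t (k + 1) - t k) * ‖e k‖ ≤ ε := by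
  refine (Finset.sum_le_sum_of_subset_of_nonneg (Finset.range_mono hi) ?_).trans h.error.le
  intro k hk _
  have := h.step_pos k (Finset.mem_range.1 hk)
  exact mul_nonneg (by linarith) (norm_nonneg _)

/-- Mesh times length: the variance in the barrier vanishes with the mesh. -/
lemma IsApproxSolution.sum_sq_le {ε T : ℝ} {n : ℕ} {t : ℕ → ℝ} {z e : ℕ → X}
    (h : IsApproxSolution A ε T n t z e) {i : ℕ} (hi : i ≤ n) :
    ∑ k ∈ Finset.range i, (t (k + 1) - t k) ^ 2 ≤ ε * T := by
  have h1 : ∑ k ∈ Finset.range i, (t (k + 1) - t k) ^ 2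
      ≤ ∑ k ∈ Finset.range i, ε * (t (k + 1) - t k) := by
    refine Finset.sum_le_sum fun k hk => ?_
    have hk' := (Finset.mem_range.1 hk).trans_le hi
    have := h.step_pos k hk'
    have := h.step_lt k hk'
    rw [sq]
    gcongr
  rw [← Finset.mul_sum, h.sum_steps] at h1
  exact h1.trans (mul_le_mul_of_nonneg_left (h.node_le_last hi) h.eps_pos.le)

/-- Kobayashi's estimate for the distance of two approximate solutions. -/
lemma IsApproxSolution.norm_sub_le_schemeBound {ε T : ℝ} {n m : ℕ} {t s : ℕ → ℝ} {z e y f : ℕ → X}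
    (hz : IsApproxSolution A ε T n t z e) (hy : IsApproxSolution A ε T m s y f)
    (hA : IsMAccretive A ω) (hω : 0 ≤ ω) (hT : 0 ≤ T) (hε : ω * ε < 1) {a b : X} (hab : (a, b) ∈ A)
    {η : ℝ} (hη : 0 < η) {i j : ℕ} (hi : i ≤ n) (hj : j ≤ m) :
    ‖z i - y j‖ ≤ schemeBound ω T ‖z 0 - a‖ ‖y 0 - a‖ ‖b‖ η (t i) ε |t i - s j| := by
  have hε0 := hz.eps_pos
  have hpos : 0 < 1 - ω * ε := by linarith
  set κ := (1 - ω * ε)⁻¹ with hκ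
  have hκ1 : 1 ≤ κ := (one_le_inv₀ hpos).2 (by nlinarith)
  set M := Real.exp (κ * ω * T) with hM
  have hM1 : 1 ≤ M := Real.one_le_exp (by positivity)
  -- Only the first scheme is discounted by its weight, so its steps are enlarged and those of the
  -- second stay as they are. Discounting both would double the exponent in the leading factor
  -- `e^{ωs}`.
  set γ : ℕ → ℝ := fun k => (1 - ω * (t (k + 1) - t k))⁻¹ * (t (k + 1) - t k) with hγ
  set δ : ℕ → ℝ := fun k => s (k + 1) - s k with hδ
  have hγ0 : ∀ k < n, 0 < γ k := fun k hk =>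
    mul_pos (inv_pos.2 (hz.factor_pos hω hε hk).2.1) (sub_pos.2 (hz.step_pos k hk))
  have hδ0 : ∀ k < m, 0 < δ k := fun k hk => sub_pos.2 (hy.step_pos k hk)
  have hγl : ∀ k < n, t (k + 1) - t k ≤ γ k := fun k hk => by
    obtain ⟨_, h2, h3⟩ := hz.factor_pos hω hε hk
    exact le_mul_of_one_le_left (sub_pos.2 (hz.step_pos k hk)).le ((one_le_inv₀ h2).2 h3)
  have hγu : ∀ k < n, γ k ≤ κ * (t (k + 1) - t k) := fun k hk => by
    obtain ⟨h1, h2, h3⟩ := hz.factor_pos hω hε hk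
    have := (sub_pos.2 (hz.step_pos k hk)).le
    simp only [hγ, hκ]
    gcongr
  have hsumδ : ∀ j, ∑ k ∈ Finset.range j, δ k = s j := hy.sum_steps
  have hsumγl : ∀ i ≤ n, t i ≤ ∑ k ∈ Finset.range i, γ k := fun i hi => by
    rw [← hz.sum_steps i]
    exact Finset.sum_le_sum fun k hk => hγl k ((Finset.mem_range.1 hk).trans_le hi)
  have hsumγu : ∀ i ≤ n, ∑ k ∈ Finset.range i, γ k ≤ κ * t i := fun i hi => by
    rw [← hz.sum_steps i, Finset.mul_sum]
    exact Finset.sum_le_sum fun k hk => hγu k ((Finset.mem_range.1 hk).trans_le hi)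
  have hzw : ∀ i ≤ n, 1 ≤ weight ω t i := fun i hi => hz.one_le_weight hω hε hi
  have hyw : ∀ j ≤ m, weight ω s j ≤ M := fun j hj => by
    refine (hy.weight_le_exp hω hε hj).trans (Real.exp_le_exp.2 ?_)
    exact mul_le_mul_of_nonneg_left (hy.node_le_last hj) (by positivity)
  -- The crude growth factor `M` of the second scheme enters through the boundary `i = 0`, where
  -- nothing is discounted. It multiplies only terms that disappear in the limits taken later, so it
  -- does not spoil the final constant.
  have hrec := le_barrier (n := n) (m := m) (c := fun i j => ‖z i - y j‖ / weight ω t i)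
    (γ := γ) (δ := δ) (ε := fun k => ‖e k‖) (φ := fun k => M * ‖f k‖)
    (B := ‖z 0 - a‖ + M * ‖y 0 - a‖) (K := M * ‖b‖) hγ0 hδ0 (by positivity) hη ?_ ?_ ?_ i hi j hj
  · have hw0 : 0 < weight ω t i := by linarith [hzw i hi]
    rw [div_le_iff₀ hw0, mul_comm] at hrec
    refine hrec.trans ?_
    rw [schemeBound, ← hκ, ← hM]
    refine mul_le_mul (hz.weight_le_exp hω hε hi) ?_ ?_ (Real.exp_pos _).le
    · have E1 : ∑ k ∈ Finset.range i, γ k * ‖e k‖ ≤ κ * ε := by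
        refine le_trans ?_ (mul_le_mul_of_nonneg_left (hz.sum_error_le hi) (by positivity))
        rw [Finset.mul_sum]
        refine Finset.sum_le_sum fun k hk => ?_
        rw [← mul_assoc]
        exact mul_le_mul_of_nonneg_right (hγu k ((Finset.mem_range.1 hk).trans_le hi))
          (norm_nonneg _)
      have E2 : ∑ k ∈ Finset.range j, δ k * (M * ‖f k‖) ≤ M * ε := by
        refine le_trans (le_of_eq ?_) (mul_le_mul_of_nonneg_left (hy.sum_error_le hj) (by positivity))
        rw [Finset.mul_sum]
        exact Finset.sum_congr rfl fun k _ => by simp only [hδ]; ring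
      have E3 : ∑ k ∈ Finset.range i, γ k ^ 2 ≤ κ ^ 2 * ε * T := by
        rw [mul_assoc]
        refine le_trans ?_ (mul_le_mul_of_nonneg_left (hz.sum_sq_le hi) (by positivity))
        rw [Finset.mul_sum]
        refine Finset.sum_le_sum fun k hk => ?_
        have hk' := (Finset.mem_range.1 hk).trans_le hi
        rw [← mul_pow]
        exact pow_le_pow_left₀ (hγ0 k hk').le (hγu k hk') 2
      have E4 : ∑ k ∈ Finset.range j, δ k ^ 2 ≤ ε * T := hy.sum_sq_le hj
      -- The enlarged steps displace the node `t i` by at most `(κ - 1) * T`.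
      have E5 : (∑ k ∈ Finset.range i, γ k - ∑ k ∈ Finset.range j, δ k) ^ 2
          ≤ (|t i - s j| + (κ - 1) * T) ^ 2 := by
        rw [← sq_abs]
        refine pow_le_pow_left₀ (abs_nonneg _) ?_ 2
        rw [hsumδ]
        have h1 := hsumγl i hi
        have h2 := hsumγu i hi
        have h3 : (κ - 1) * t i ≤ (κ - 1) * T :=
          mul_le_mul_of_nonneg_left (hz.node_le_last hi) (by linarith)
        have h4 : ∑ k ∈ Finset.range i, γ k - s j
            = (t i - s j) + (∑ k ∈ Finset.range i, γ k - t i) := by ring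
        rw [h4]
        refine (abs_add_le _ _).trans (add_le_add_right ?_ _)
        rw [abs_of_nonneg (by linarith)]
        linarith
      have E6 := div_le_div_of_nonneg_right (add_le_add E5 (add_le_add E3 E4)) hη.le
      have E7 := mul_le_mul_of_nonneg_left (add_le_add_left E6 η)
        (show 0 ≤ M * ‖b‖ / 2 by positivity)
      linarith
    · have hs1 : 0 ≤ ∑ k ∈ Finset.range i, γ k * ‖e k‖ := Finset.sum_nonneg fun k hk =>
        mul_nonneg (hγ0 k ((Finset.mem_range.1 hk).trans_le hi)).le (norm_nonneg _)
      have hs2 : 0 ≤ ∑ k ∈ Finset.range j, δ k * (M * ‖f k‖) := Finset.sum_nonneg fun k hk =>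
        mul_nonneg (hδ0 k ((Finset.mem_range.1 hk).trans_le hj)).le (by positivity)
      have hs3 : 0 ≤ ∑ k ∈ Finset.range i, γ k ^ 2 := Finset.sum_nonneg fun k _ => sq_nonneg _
      have hs4 : 0 ≤ ∑ k ∈ Finset.range j, δ k ^ 2 := Finset.sum_nonneg fun k _ => sq_nonneg _
      positivity
  · intro i hi
    have hw0 : 0 < weight ω t i := by linarith [hzw i hi]
    have h1 := hz.norm_sub_dom_le hA hω hε hab hi
    have h2 : ‖z i - y 0‖ ≤ ‖z i - a‖ + ‖y 0 - a‖ := by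
      have := norm_sub_le (z i - a) (y 0 - a)
      rwa [sub_sub_sub_cancel_right] at this
    rw [div_le_iff₀ hw0, mul_comm _ (weight ω t i)]
    refine h2.trans ((add_le_add_left h1 _).trans ?_)
    have h3 : ‖y 0 - a‖ ≤ weight ω t i * (M * ‖y 0 - a‖) := by
      rw [← mul_assoc]
      exact le_mul_of_one_le_left (norm_nonneg _) (one_le_mul_of_one_le_of_one_le (hzw i hi) hM1)
    have h4 : ∑ k ∈ Finset.range i, (t (k + 1) - t k) * ‖e k‖
        ≤ ∑ k ∈ Finset.range i, γ k * ‖e k‖ := Finset.sum_le_sum fun k hk =>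
      mul_le_mul_of_nonneg_right (hγl k ((Finset.mem_range.1 hk).trans_le hi)) (norm_nonneg _)
    have h5 : t i * ‖b‖ ≤ M * ‖b‖ * ∑ k ∈ Finset.range i, γ k := by
      have h6 := mul_le_mul_of_nonneg_right (hsumγl i hi) (norm_nonneg b)
      have h7 : 0 ≤ (∑ k ∈ Finset.range i, γ k) * ‖b‖ :=
        mul_nonneg ((hz.node_nonneg hi).trans (hsumγl i hi)) (norm_nonneg _)
      have h8 := le_mul_of_one_le_left h7 hM1
      linarith
    have h9 := mul_le_mul_of_nonneg_left (add_le_add (add_le_add_right h4 ‖z 0 - a‖) h5) hw0.le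
    linarith
  · intro j hj
    have h1 := hy.norm_sub_dom_le hA hω hε hab hj
    have h2 : ‖z 0 - y j‖ ≤ ‖z 0 - a‖ + ‖y j - a‖ := by
      have := norm_sub_le (z 0 - a) (y j - a)
      rwa [sub_sub_sub_cancel_right] at this
    have h0 : weight ω t 0 = 1 := by simp [weight]
    rw [h0, div_one]
    have h3 : ‖y j - a‖ ≤ M * (‖y 0 - a‖
        + ∑ k ∈ Finset.range j, (s (k + 1) - s k) * ‖f k‖ + s j * ‖b‖) := by
      refine h1.trans (mul_le_mul_of_nonneg_right (hyw j hj) ?_)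
      have hs2 : 0 ≤ ∑ k ∈ Finset.range j, (s (k + 1) - s k) * ‖f k‖ :=
        Finset.sum_nonneg fun k hk =>
          mul_nonneg (hδ0 k ((Finset.mem_range.1 hk).trans_le hj)).le (norm_nonneg _)
      have := hy.node_nonneg hj
      positivity
    have h4 : ∑ k ∈ Finset.range j, δ k * (M * ‖f k‖)
        = M * ∑ k ∈ Finset.range j, (s (k + 1) - s k) * ‖f k‖ := by
      rw [Finset.mul_sum]
      exact Finset.sum_congr rfl fun k _ => by simp only [hδ]; ring
    rw [h4, hsumδ]
    linarith
  -- The coefficient in `two_step` is `g + q * δ j` with `q = 1 - ω * g`. Division by `q * W`, which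
  -- is the weight at `i`, turns it into `γ i + δ j` and yields the recursion.
  · intro i hi j hj
    obtain ⟨_, hf, _⟩ := hz.factor_pos hω hε hi
    have hg := sub_pos.2 (hz.step_pos i hi)
    have hd := hδ0 j hj
    have hw1 := hzw (i + 1) hi
    have hw2 := hz.weight_succ hω hε hi
    have h1 := hA.two_step hω hg hd (by linarith) (hz.scheme i hi) (hy.scheme j hj)
    have hw : 0 < weight ω t (i + 1) := by linarith
    simp only [hγ, ← hw2]
    set W := weight ω t (i + 1)
    set g := t (i + 1) - t i
    set q := 1 - ω * g with hq
    have h2 : g * δ j * (‖e i‖ + ‖f j‖) ≤ g * δ j * (‖e i‖ + M * ‖f j‖) * W := by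
      have h3 : ‖e i‖ + ‖f j‖ ≤ ‖e i‖ + M * ‖f j‖ :=
        add_le_add_right (le_mul_of_one_le_left (norm_nonneg _) hM1) _
      have h4 : 0 ≤ g * δ j := by positivity
      refine (mul_le_mul_of_nonneg_left h3 h4).trans (le_mul_of_one_le_right ?_ hw1)
      positivity
    have h5 : (g + q * δ j) * ‖z (i + 1) - y (j + 1)‖ ≤ g * ‖z (i + 1) - y j‖
        + δ j * ‖z i - y (j + 1)‖ + g * δ j * (‖e i‖ + M * ‖f j‖) * W := by
      refine le_trans (le_of_eq ?_) (h1.trans (add_le_add_right h2 _))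
      rw [hq]
      ring
    have h6 := mul_le_mul_of_nonneg_left h5 (show 0 ≤ q⁻¹ * W⁻¹ by positivity)
    have l1 : (q⁻¹ * g + δ j) * (‖z (i + 1) - y (j + 1)‖ / W)
        = q⁻¹ * W⁻¹ * ((g + q * δ j) * ‖z (i + 1) - y (j + 1)‖) := by
      field_simp
    have l2 : q⁻¹ * g * (‖z (i + 1) - y j‖ / W) + δ j * (‖z i - y (j + 1)‖ / (q * W))
        + q⁻¹ * g * δ j * (‖e i‖ + M * ‖f j‖)
        = q⁻¹ * W⁻¹ * (g * ‖z (i + 1) - y j‖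
        + δ j * ‖z i - y (j + 1)‖ + g * δ j * (‖e i‖ + M * ‖f j‖) * W) := by
      field_simp
    rw [l1, l2]
    exact h6

end Scheme

/-! ### Mild solutions: comparison and translation. -/

section Mild
variable {X : Type*} [NormedAddCommGroup X] [NormedSpace ℝ X] {A : Set (X × X)} {ω : ℝ}

lemma schemeBound_mono {T r₀ r₀' r₁ r₁' b η s s' ε d d' : ℝ} (hω : 0 ≤ ω) (hT : 0 ≤ T) (hε0 : 0 ≤ ε)
    (hε : ω * ε < 1) (hb : 0 ≤ b) (hη : 0 < η) (hr : 0 ≤ r₀) (hr' : 0 ≤ r₁) (hd0 : 0 ≤ d)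
    (h0 : r₀ ≤ r₀') (h1 : r₁ ≤ r₁') (hs : s ≤ s') (hd : d ≤ d') :
    schemeBound ω T r₀ r₁ b η s ε d ≤ schemeBound ω T r₀' r₁' b η s' ε d' := by
  have hpos : 0 < 1 - ω * ε := by linarith
  have hκ1 : 0 ≤ (1 - ω * ε)⁻¹ - 1 :=
    sub_nonneg.2 ((one_le_inv₀ hpos).2 (by linarith [mul_nonneg hω hε0]))
  have hκ0 : 0 ≤ (1 - ω * ε)⁻¹ := (inv_pos.2 hpos).le
  unfold schemeBound
  gcongr

lemma continuousAt_inv_one_sub_mul (ω : ℝ) : ContinuousAt (fun ε : ℝ => (1 - ω * ε)⁻¹) 0 := by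
  refine ContinuousAt.inv₀ (by fun_prop) ?_
  simp

/-- As the mesh vanishes, the quadratic term disappears and only `η / 2` remains of the barrier. The
distance `3 * ε` leaves slack for every pair of nodes compared below. -/
lemma tendsto_schemeBound (ω T r₀ r₁ b η s : ℝ) :
    Tendsto (fun ε => schemeBound ω T (r₀ + ε) (r₁ + ε) b η (s + ε) ε (3 * ε)) (𝓝[>] 0)
      (𝓝 (Real.exp (ω * s) * (r₀ + Real.exp (ω * T) * r₁ + Real.exp (ω * T) * b * η / 2))) := by
  have hc : ContinuousAt
      (fun ε => schemeBound ω T (r₀ + ε) (r₁ + ε) b η (s + ε) ε (3 * ε)) 0 := by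
    have h1 := continuousAt_inv_one_sub_mul ω
    unfold schemeBound
    fun_prop
  have := hc.tendsto.mono_left (nhdsWithin_le_nhds (s := Ioi 0))
  simpa [schemeBound] using this

lemma eventually_small (ω : ℝ) {r : ℝ} (hr : 0 < r) :
    ∀ᶠ ε : ℝ in 𝓝[>] 0, 0 < ε ∧ ε < r ∧ ω * ε < 1 := by
  have h1 : ∀ᶠ ε : ℝ in 𝓝 0, ω * ε < 1 :=
    (show Continuous fun ε : ℝ => ω * ε by fun_prop).continuousAt.eventually_lt
      continuousAt_const (by simp)
  filter_upwards [self_mem_nhdsWithin, Ioo_mem_nhdsGT hr, nhdsWithin_le_nhds h1] with ε e1 e2 e3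
  exact ⟨e1, e2.2, e3⟩

lemma IsMildSolution.exists_node {x : X} {u : ℝ → X} (hu : IsMildSolution A x u) {T s ε : ℝ}
    (hs : 0 ≤ s) (hε : 0 < ε) (hsT : s + ε ≤ T) :
    ∃ n t z e i, IsApproxSolution A ε T n t z e ∧ ‖x - z 0‖ ≤ ε ∧ i ≤ n ∧
      s ≤ t i ∧ t i ≤ s + ε ∧ ‖u s - z i‖ ≤ ε := by
  obtain ⟨n, t, z, e, h, h0, hz⟩ := hu.approx T (by linarith) ε hε
  refine ⟨n, t, z, e, ?_⟩
  -- Time `0` lies in none of the intervals `(t i, t (i + 1)]` and is represented by the node `0`.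
  rcases hs.eq_or_lt with rfl | hs
  · exact ⟨0, h, hu.initial ▸ h0, Nat.zero_le n, h.start.ge, by simp [h.start, hε.le], h0⟩
  · obtain ⟨i, hi, hsi⟩ := h.exists_mem_Ioc hs (by linarith [h.lt_last])
    exact ⟨i + 1, h, hu.initial ▸ h0, hi, hsi.2, by linarith [h.step_lt i hi, hsi.1], hz i hi s hsi⟩

/-- Distance of a mild solution to a point of the domain. -/
lemma IsMildSolution.norm_sub_dom_le {x : X} {u : ℝ → X} (hu : IsMildSolution A x u)
    (hA : IsMAccretive A ω) (hω : 0 ≤ ω) {a b : X} (hab : (a, b) ∈ A) {s : ℝ} (hs : 0 ≤ s) :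
    ‖u s - a‖ ≤ Real.exp (ω * s) * (‖x - a‖ + s * ‖b‖) := by
  have hlim : Tendsto (fun ε : ℝ => ε + Real.exp ((1 - ω * ε)⁻¹ * ω * (s + ε))
      * (‖x - a‖ + ε + ε + (s + ε) * ‖b‖)) (𝓝[>] 0)
      (𝓝 (Real.exp (ω * s) * (‖x - a‖ + s * ‖b‖))) := by
    have hc : ContinuousAt (fun ε : ℝ => ε + Real.exp ((1 - ω * ε)⁻¹ * ω * (s + ε))
        * (‖x - a‖ + ε + ε + (s + ε) * ‖b‖)) 0 := by
      have h1 := continuousAt_inv_one_sub_mul ω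
      fun_prop
    have := hc.tendsto.mono_left (nhdsWithin_le_nhds (s := Ioi 0))
    simpa using this
  refine ge_of_tendsto hlim ?_
  filter_upwards [eventually_small ω one_pos] with ε ⟨e1, e2, e3⟩
  obtain ⟨n, t, z, e, i, h, h0, hi, -, hi2, hz⟩ := hu.exists_node hs e1 le_rfl
  have h1 := h.norm_sub_dom_le hA hω e3 hab hi
  have hpos : 0 < 1 - ω * ε := by linarith
  have hw : weight ω t i ≤ Real.exp ((1 - ω * ε)⁻¹ * ω * (s + ε)) :=
    (h.weight_le_exp hω e3 hi).trans (Real.exp_le_exp.2 (by gcongr))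
  have h2 : ‖z 0 - a‖ ≤ ‖x - a‖ + ε := by
    have := norm_sub_le_norm_sub_add_norm_sub (z 0) x a
    rw [norm_sub_rev] at h0
    linarith
  have h3 : ‖u s - a‖ ≤ ‖u s - z i‖ + ‖z i - a‖ := norm_sub_le_norm_sub_add_norm_sub _ _ _
  refine h3.trans (add_le_add hz (h1.trans ?_))
  have h4 := h.node_nonneg hi
  have h5 := h.sum_error_le hi
  have h6 : 0 ≤ ∑ k ∈ Finset.range i, (t (k + 1) - t k) * ‖e k‖ := Finset.sum_nonneg fun k hk =>
    mul_nonneg (sub_pos.2 (h.step_pos k ((Finset.mem_range.1 hk).trans_le hi))).le (norm_nonneg _)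
  gcongr

/-- Mild solutions depend continuously on the initial value. -/
lemma IsMildSolution.norm_sub_le {x y : X} {u v : ℝ → X} (hu : IsMildSolution A x u)
    (hv : IsMildSolution A y v) (hy : y ∈ closure (dom A)) (hA : IsMAccretive A ω) (hω : 0 ≤ ω)
    {s : ℝ} (hs : 0 ≤ s) : ‖u s - v s‖ ≤ Real.exp (ω * s) * ‖x - y‖ := by
  -- The limits are taken in the order mesh to `0`, then `η → 0`, which removes the possibly huge
  -- `‖b‖`, then `a → y`.
  have key : ∀ a b : X, (a, b) ∈ A → ∀ η > 0, ‖u s - v s‖ ≤ Real.exp (ω * s) *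
      (‖x - a‖ + Real.exp (ω * (s + 1)) * ‖y - a‖ + Real.exp (ω * (s + 1)) * ‖b‖ * η / 2) := by
    intro a b hab η hη
    have hid : Tendsto (fun ε : ℝ => 2 * ε) (𝓝[>] 0) (𝓝 0) := by
      have : Continuous fun ε : ℝ => 2 * ε := by fun_prop
      simpa using (this.tendsto 0).mono_left (nhdsWithin_le_nhds (s := Ioi 0))
    have hlim := hid.add (tendsto_schemeBound ω (s + 1) ‖x - a‖ ‖y - a‖ ‖b‖ η s)
    rw [zero_add] at hlim
    refine ge_of_tendsto hlim ?_
    filter_upwards [eventually_small ω one_pos] with ε ⟨e1, e2, e3⟩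
    obtain ⟨n, t, z, e, i, h, h0, hi, hi1, hi2, hz⟩ := hu.exists_node (T := s + 1) hs e1 (by linarith)
    obtain ⟨m, t', z', e', j, h', h0', hj, hj1, hj2, hz'⟩ :=
      hv.exists_node (T := s + 1) hs e1 (by linarith)
    have h1 := h.norm_sub_le_schemeBound h' hA hω (by linarith) e3 hab hη hi hj
    have h2 : ‖z 0 - a‖ ≤ ‖x - a‖ + ε := by
      have := norm_sub_le_norm_sub_add_norm_sub (z 0) x a
      rw [norm_sub_rev] at h0
      linarith
    have h2' : ‖z' 0 - a‖ ≤ ‖y - a‖ + ε := by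
      have := norm_sub_le_norm_sub_add_norm_sub (z' 0) y a
      rw [norm_sub_rev] at h0'
      linarith
    have h3 : ‖u s - v s‖ ≤ ‖u s - z i‖ + ‖z i - z' j‖ + ‖v s - z' j‖ := by
      have e1 := norm_sub_le_norm_sub_add_norm_sub (u s) (z i) (v s)
      have e2 := norm_sub_le_norm_sub_add_norm_sub (z i) (z' j) (v s)
      rw [norm_sub_rev (z' j)] at e2
      linarith
    have h4 : schemeBound ω (s + 1) ‖z 0 - a‖ ‖z' 0 - a‖ ‖b‖ η (t i) ε |t i - t' j|
        ≤ schemeBound ω (s + 1) (‖x - a‖ + ε) (‖y - a‖ + ε) ‖b‖ η (s + ε) ε (3 * ε) := by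
      refine schemeBound_mono hω (by linarith) e1.le e3 (norm_nonneg _) hη (norm_nonneg _)
        (norm_nonneg _) (abs_nonneg _) h2 h2' hi2 ?_
      rw [abs_le]
      constructor <;> linarith
    linarith
  have key2 : ∀ a ∈ dom A, ‖u s - v s‖ ≤ Real.exp (ω * s) *
      (‖x - a‖ + Real.exp (ω * (s + 1)) * ‖y - a‖) := by
    rintro a ⟨b, hab⟩
    have hlim : Tendsto (fun η : ℝ => Real.exp (ω * s) *
      (‖x - a‖ + Real.exp (ω * (s + 1)) * ‖y - a‖ + Real.exp (ω * (s + 1)) * ‖b‖ * η / 2))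
      (𝓝[>] 0) (𝓝 (Real.exp (ω * s) * (‖x - a‖ + Real.exp (ω * (s + 1)) * ‖y - a‖))) := by
      have hc : Continuous fun η : ℝ => Real.exp (ω * s) *
        (‖x - a‖ + Real.exp (ω * (s + 1)) * ‖y - a‖ + Real.exp (ω * (s + 1)) * ‖b‖ * η / 2) := by
        fun_prop
      simpa using (hc.tendsto 0).mono_left (nhdsWithin_le_nhds (s := Ioi 0))
    refine ge_of_tendsto hlim ?_
    filter_upwards [self_mem_nhdsWithin] with η hη using key a b hab η hη
  have hclosed : IsClosed {a : X | ‖u s - v s‖ ≤ Real.exp (ω * s) *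
      (‖x - a‖ + Real.exp (ω * (s + 1)) * ‖y - a‖)} :=
    isClosed_le continuous_const (by fun_prop)
  have hfin : ‖u s - v s‖ ≤ Real.exp (ω * s) *
      (‖x - y‖ + Real.exp (ω * (s + 1)) * ‖y - y‖) :=
    closure_minimal (fun a ha => key2 a ha) hclosed hy
  simpa using hfin

/-- Translates of mild solutions are mild solutions. -/
lemma IsMildSolution.translate {x : X} {u : ℝ → X} (hu : IsMildSolution A x u) {h : ℝ} (hh : 0 < h) :
    IsMildSolution A (u h) (fun t => u (h + t)) where
  continuousOn := by
    refine hu.continuousOn.comp (by fun_prop) ?_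
    intro t ht
    exact add_nonneg hh.le ht
  initial := by simp
  approx := by
    intro T hT ε hε
    have hcomp : UniformContinuousOn u (Icc 0 (h + T + 1)) :=
      isCompact_Icc.uniformContinuousOn_of_continuous (hu.continuousOn.mono fun t ht => ht.1)
    obtain ⟨d, hd, hud⟩ := Metric.uniformContinuousOn_iff.1 hcomp (ε / 2) (by linarith)
    -- The scheme is cut at the first node at or after `h`, which overshoots `h` by less than `r`.
    -- Uniform continuity absorbs this shift once `r < d`. The shifted last node exceeds `T - 2 *
    -- r`, hence `2 * r < ε`; `r < T` guarantees that the grid reaches `h`, and `r < 1` keeps all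
    -- times in the compact interval.
    obtain ⟨r, hr0, hr⟩ : ∃ r : ℝ, 0 < r ∧ r < d ∧ 2 * r < ε ∧ r < T ∧ r < 1 := by
      refine ⟨min (min d ε) (min T 1) / 4, by positivity, ?_, ?_, ?_, ?_⟩ <;>
      · have h1 : min (min d ε) (min T 1) ≤ d := (min_le_left _ _).trans (min_le_left _ _)
        have h2 : min (min d ε) (min T 1) ≤ ε := (min_le_left _ _).trans (min_le_right _ _)
        have h3 : min (min d ε) (min T 1) ≤ T := (min_le_right _ _).trans (min_le_left _ _)
        have h4 : min (min d ε) (min T 1) ≤ 1 := (min_le_right _ _).trans (min_le_right _ _)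
        linarith
    obtain ⟨hrd, hrε, hrT, hr1⟩ := hr
    obtain ⟨n, t, z, e, hz, -, hzu⟩ := hu.approx (h + T) (by linarith) r hr0
    obtain ⟨i, hi, hhi⟩ := hz.exists_mem_Ioc hh (by linarith [hz.lt_last])
    have hclose : ∀ s ≥ 0, ∀ s' ≥ 0, s ≤ h + T + 1 → s' ≤ h + T + 1 → |s - s'| ≤ r →
        ‖u s - u s'‖ ≤ ε / 2 := by
      intro s hs s' hs' h1 h2 h3
      rw [← dist_eq_norm]
      exact (hud s ⟨hs, h1⟩ s' ⟨hs', h2⟩ (by rw [Real.dist_eq]; linarith)).le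
    have hih : t (i + 1) ≤ h + r := by linarith [hz.step_lt i hi, hhi.1]
    refine ⟨n - (i + 1), fun k => t (i + 1 + k) - t (i + 1), fun k => z (i + 1 + k),
      fun k => e (i + 1 + k), ⟨by simp, ?_, ?_, ?_, ?_, ?_, ?_⟩, ?_, ?_⟩
    · intro k hk
      have := hz.step_pos (i + 1 + k) (by omega)
      simpa [← add_assoc] using this
    · intro k hk
      have := hz.step_lt (i + 1 + k) (by omega)
      simp only [← add_assoc]
      linarith
    · have : i + 1 + (n - (i + 1)) = n := by omega
      simp only [this]
      linarith [hz.lt_last]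
    · have : i + 1 + (n - (i + 1)) = n := by omega
      simp only [this]
      linarith [hz.last_le, hhi.2]
    · have h1 := hz.error
      have h2 : n = (i + 1) + (n - (i + 1)) := by omega
      rw [h2, Finset.sum_range_add] at h1
      have h3 : 0 ≤ ∑ k ∈ Finset.range (i + 1), (t (k + 1) - t k) * ‖e k‖ :=
        Finset.sum_nonneg fun k hk => mul_nonneg
          (sub_pos.2 (hz.step_pos k (by have := Finset.mem_range.1 hk; omega))).le (norm_nonneg _)
      simp only [← add_assoc, sub_sub_sub_cancel_right] at h1 ⊢
      linarith
    · intro k hk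
      have := hz.scheme (i + 1 + k) (by omega)
      simpa only [← add_assoc, sub_sub_sub_cancel_right] using this
    · have h1 := hzu i hi (t (i + 1)) ⟨hz.step_pos i hi, le_rfl⟩
      have h2 := hclose h hh.le (t (i + 1)) (by linarith [hhi.2]) (by linarith) (by linarith)
        (by rw [abs_le]; constructor <;> linarith [hhi.2])
      have h3 := norm_sub_le_norm_sub_add_norm_sub (u h) (u (t (i + 1))) (z (i + 1))
      simp only [add_zero]
      linarith
    · intro k hk s hs
      simp only [← add_assoc, mem_Ioc] at hs
      have hs0 : t (i + 1) ≤ t (i + 1 + k) := hz.node_le (by omega) (by omega)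
      have hsT : t (i + 1 + k + 1) ≤ h + T := hz.node_le_last (by omega)
      have h1 := hzu (i + 1 + k) (by omega) (t (i + 1) + s) ⟨by linarith, by linarith⟩
      have h2 := hclose (h + s) (by linarith) (t (i + 1) + s) (by linarith [hhi.2])
        (by linarith [hhi.2]) (by linarith) (by rw [abs_le]; constructor <;> linarith [hhi.2])
      have h3 := norm_sub_le_norm_sub_add_norm_sub (u (h + s)) (u (t (i + 1) + s))
        (z (i + 1 + k + 1))
      simp only [← add_assoc]
      linarith

end Mild

/-! ### Existence of mild solutions and the semigroup. -/

section Existence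
variable {X : Type*} [NormedAddCommGroup X] [NormedSpace ℝ X] {A : Set (X × X)} {ω : ℝ}

/-- Two fine approximate solutions whose initial values are close to a point of the closure of the
domain are close to each other at nodes which are close to each other. -/
lemma exists_eps_norm_sub_le (hA : IsMAccretive A ω) (hω : 0 ≤ ω) {x : X}
    (hx : x ∈ closure (dom A)) {T : ℝ} (hT : 0 < T) {r : ℝ} (hr : 0 < r) :
    ∃ ε > 0, ∀ n t z e m s y f, IsApproxSolution A ε T n t z e → IsApproxSolution A ε T m s y f →
      z 0 = x → y 0 = x → ∀ i ≤ n, ∀ j ≤ m, |t i - s j| ≤ 3 * ε → ‖z i - y j‖ ≤ r := by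
  set M := Real.exp (ω * T) with hM
  have hM0 : 0 < M := Real.exp_pos _
  -- The error `r` is split evenly: `a` is chosen so that the initial distances contribute less than
  -- `r / 2`, and then `η`, depending on `‖b‖`, for the other half.
  obtain ⟨a, ⟨b, hab⟩, hxa⟩ := Metric.mem_closure_iff.1 hx (r / (2 * (M * (1 + M)))) (by positivity)
  rw [dist_eq_norm, lt_div_iff₀ (by positivity)] at hxa
  obtain ⟨η, hη, hηr⟩ : ∃ η > 0, M * (M * ‖b‖ * η / 2) < r / 2 := by
    refine ⟨r / (M * M * (‖b‖ + 1)), by positivity, ?_⟩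
    have : M * (M * ‖b‖ * (r / (M * M * (‖b‖ + 1))) / 2) = r / 2 * (‖b‖ / (‖b‖ + 1)) := by
      field_simp
    rw [this]
    refine mul_lt_of_lt_one_right (by positivity) ?_
    rw [div_lt_one (by positivity)]
    linarith
  have hlim := tendsto_schemeBound ω T ‖x - a‖ ‖x - a‖ ‖b‖ η T
  have hval : Real.exp (ω * T) * (‖x - a‖ + Real.exp (ω * T) * ‖x - a‖
      + Real.exp (ω * T) * ‖b‖ * η / 2) < r := by
    rw [← hM]
    linarith
  obtain ⟨ε, hε, e1, e2, e3⟩ :=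
    ((hlim.eventually (eventually_lt_nhds hval)).and (eventually_small ω one_pos)).exists
  refine ⟨ε, e1, fun n t z e m s y f hz hy hz0 hy0 i hi j hj hij => ?_⟩
  refine (hz.norm_sub_le_schemeBound hy hA hω hT.le e3 hab hη hi hj).trans (le_trans ?_ hε.le)
  refine schemeBound_mono hω hT.le e1.le e3 (norm_nonneg _) hη (norm_nonneg _) (norm_nonneg _)
    (abs_nonneg _) ?_ ?_ ?_ hij
  · rw [hz0]; linarith
  · rw [hy0]; linarith
  · linarith [hz.node_le_last hi]

/-- The implicit Euler scheme with constant step. -/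
lemma IsMAccretive.exists_euler (hA : IsMAccretive A ω) {l : ℝ} (hl : 0 < l) (hlω : l * ω < 1)
    (x : X) : ∃ z : ℕ → X, z 0 = x ∧ ∀ i, (z (i + 1), (0 : X) - l⁻¹ • (z (i + 1) - z i)) ∈ A := by
  choose J f hJ hf using fun y => hA.surjective l hl hlω y
  refine ⟨fun i => Nat.rec x (fun _ y => J y) i, rfl, fun i => ?_⟩
  set y : X := Nat.rec x (fun _ y => J y) i
  have h1 : f y = (0 : X) - l⁻¹ • (J y - y) := by
    rw [eq_comm]
    nth_rewrite 2 [← hf y]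
    rw [sub_add_cancel_left, smul_neg, smul_smul, inv_mul_cancel₀ hl.ne', one_smul, zero_sub,
      neg_neg]
  have := hJ y
  rwa [h1] at this

lemma isApproxSolution_euler {l ε T : ℝ} (hl : 0 < l) (hlε : l < ε) (hT : 0 ≤ T) {z : ℕ → X}
    (hz : ∀ i, (z (i + 1), (0 : X) - l⁻¹ • (z (i + 1) - z i)) ∈ A) :
    IsApproxSolution A ε T ⌊T / l⌋₊ (fun i => i * l) z (fun _ => 0) where
  start := by simp
  step_pos i _ := by push_cast; linarith
  step_lt i _ := by push_cast; linarith
  lt_last := by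
    have := Nat.lt_floor_add_one (T / l)
    rw [div_lt_iff₀ hl] at this
    linarith
  last_le := by
    have := Nat.floor_le (show 0 ≤ T / l by positivity)
    rwa [le_div_iff₀ hl] at this
  error := by simpa using hl.trans hlε
  scheme i _ := by
    have : ((i + 1 : ℕ) : ℝ) * l - i * l = l := by push_cast; ring
    simp only [this]
    exact hz i

lemma ceil_div_bounds {l s : ℝ} (hl : 0 < l) (hs : 0 ≤ s) :
    s ≤ ⌈s / l⌉₊ * l ∧ ⌈s / l⌉₊ * l ≤ s + l := by
  have h1 := Nat.le_ceil (s / l)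
  have h2 := (Nat.ceil_lt_add_one (show 0 ≤ s / l by positivity)).le
  rw [div_le_iff₀ hl] at h1
  have h3 := mul_le_mul_of_nonneg_right h2 hl.le
  rw [add_mul, div_mul_cancel₀ _ hl.ne', one_mul] at h3
  exact ⟨h1, h3⟩

/-- The theorem of Crandall and Liggett: existence of mild solutions. -/
theorem IsMAccretive.exists_isMildSolution [CompleteSpace X] (hA : IsMAccretive A ω) (hω : 0 ≤ ω)
    {x : X} (hx : x ∈ closure (dom A)) : ∃ u, IsMildSolution A x u := by
  set l : ℕ → ℝ := fun k => 1 / ((k : ℝ) + 1 + ω) with hl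
  have hl0 : ∀ k, 0 < l k := fun k => by simp only [hl]; positivity
  have hl1 : ∀ k, l k ≤ 1 := fun k => by
    simp only [hl]
    rw [div_le_one (by positivity)]
    linarith [Nat.cast_nonneg (α := ℝ) k]
  have hlω : ∀ k, l k * ω < 1 := fun k => by
    simp only [hl]
    rw [div_mul_eq_mul_div, div_lt_one (by positivity)]
    linarith [Nat.cast_nonneg (α := ℝ) k]
  have hlim : Tendsto l atTop (𝓝 0) := by
    refine tendsto_const_nhds.div_atTop ?_
    exact tendsto_atTop_add_const_right _ _
      (tendsto_atTop_add_const_right _ _ tendsto_natCast_atTop_atTop)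
  choose z hz0 hz using fun k => hA.exists_euler (hl0 k) (hlω k) x
  -- The ceiling matches the convention that the value `z (i + 1)` is taken on `(t i, t (i + 1)]`.
  set U : ℕ → ℝ → X := fun k s => z k ⌈s / l k⌉₊ with hU
  -- One estimate serves three times: `s = s'` gives the Cauchy property and uniform convergence,
  -- and `k = k'` gives continuity of the limit. The schemes run up to `T + 1`, because the ceiling
  -- may pass `T` by one step.
  have main : ∀ T > 0, ∀ r > 0, ∃ ε > 0, ∀ k k', l k < ε → l k' < ε → ∀ s ∈ Icc 0 T, ∀ s' ∈ Icc 0 T,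
      |s - s'| ≤ ε → ‖U k s - U k' s'‖ ≤ r := by
    intro T hT r hr
    obtain ⟨ε, hε, h⟩ := exists_eps_norm_sub_le hA hω hx (show 0 < T + 1 by linarith) hr
    refine ⟨ε, hε, fun k k' hk hk' s hs s' hs' hss => ?_⟩
    have hidx : ∀ k, ∀ s ∈ Icc 0 T, ⌈s / l k⌉₊ ≤ ⌊(T + 1) / l k⌋₊ := fun k s hs => by
      rw [Nat.le_floor_iff (by have := hl0 k; positivity), le_div_iff₀ (hl0 k)]
      linarith [(ceil_div_bounds (hl0 k) hs.1).2, hl1 k, hs.2]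
    refine h _ _ _ _ _ _ _ _ (isApproxSolution_euler (hl0 k) hk (by linarith) (hz k))
      (isApproxSolution_euler (hl0 k') hk' (by linarith) (hz k')) (hz0 k) (hz0 k') _
      (hidx k s hs) _ (hidx k' s' hs') ?_
    obtain ⟨a1, a2⟩ := ceil_div_bounds (hl0 k) hs.1
    obtain ⟨b1, b2⟩ := ceil_div_bounds (hl0 k') hs'.1
    obtain ⟨c1, c2⟩ := abs_le.1 hss
    rw [abs_le]
    constructor <;> linarith
  have hcau : ∀ s, ∃ v, 0 ≤ s → Tendsto (fun k => U k s) atTop (𝓝 v) := by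
    intro s
    by_cases hs : 0 ≤ s
    · have : CauchySeq fun k => U k s := by
        refine Metric.cauchySeq_iff.2 fun r hr => ?_
        obtain ⟨ε, hε, h⟩ := main (s + 1) (by linarith) (r / 2) (by linarith)
        obtain ⟨N, hN⟩ := eventually_atTop.1 (hlim.eventually (eventually_lt_nhds hε))
        refine ⟨N, fun k hk k' hk' => ?_⟩
        have := h k k' (hN k hk) (hN k' hk') s ⟨hs, by linarith⟩ s ⟨hs, by linarith⟩
          (by simpa using hε.le)
        rw [dist_eq_norm]
        linarith
      obtain ⟨v, hv⟩ := cauchySeq_tendsto_of_complete this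
      exact ⟨v, fun _ => hv⟩
    · exact ⟨0, fun h => absurd h hs⟩
  choose u hu using hcau
  refine ⟨u, ⟨?_, ?_, ?_⟩⟩
  · intro s hs
    have hs' : 0 ≤ s := hs
    refine Metric.continuousWithinAt_iff.2 fun r hr => ?_
    obtain ⟨ε, hε, h⟩ := main (s + 1) (by linarith) (r / 2) (by linarith)
    refine ⟨min ε 1, by positivity, fun s' hs0 hd => ?_⟩
    have hs0' : 0 ≤ s' := hs0
    rw [Real.dist_eq] at hd
    have hd1 : |s' - s| ≤ ε := (hd.trans_le (min_le_left _ _)).le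
    have hd2 := (abs_lt.1 (hd.trans_le (min_le_right _ _))).2
    have : ‖u s' - u s‖ ≤ r / 2 := by
      refine le_of_tendsto ((hu s' hs0').sub (hu s hs')).norm ?_
      filter_upwards [hlim.eventually (eventually_lt_nhds hε)] with k hk
      exact h k k hk hk s' ⟨hs0', by linarith⟩ s ⟨hs', by linarith⟩ hd1
    rw [dist_eq_norm]
    linarith
  · refine tendsto_nhds_unique (hu 0 le_rfl) ?_
    simp [hU, hz0]
  · intro T hT r hr
    obtain ⟨ε, hε, h⟩ := main T hT r hr
    obtain ⟨k, hk1, hk2⟩ := ((hlim.eventually (eventually_lt_nhds hε)).and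
      (hlim.eventually (eventually_lt_nhds hr))).exists
    have hclose : ∀ s ∈ Icc 0 T, ‖u s - U k s‖ ≤ r := by
      intro s hs
      refine le_of_tendsto ((hu s hs.1).sub tendsto_const_nhds).norm ?_
      filter_upwards [hlim.eventually (eventually_lt_nhds hε)] with k' hk'
      exact h k' k hk' hk1 s hs s hs (by simpa using hε.le)
    have happ := isApproxSolution_euler (hl0 k) hk2 hT.le (hz k)
    refine ⟨_, _, _, _, happ, ?_, ?_⟩
    · have := hclose 0 ⟨le_rfl, hT.le⟩
      simpa [hU] using this
    · intro i hi s hs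
      have hs0 : 0 < s := (mul_nonneg (Nat.cast_nonneg i) (hl0 k).le).trans_lt hs.1
      have hsT : s ≤ T := hs.2.trans (happ.node_le_last hi)
      have hceil : ⌈s / l k⌉₊ = i + 1 := by
        rw [Nat.ceil_eq_iff (Nat.succ_ne_zero i), lt_div_iff₀ (hl0 k), div_le_iff₀ (hl0 k)]
        exact ⟨by simpa using hs.1, hs.2⟩
      have := hclose s ⟨hs0.le, hsT⟩
      simpa only [hU, hceil] using this

/-- The estimates above hold for every mild solution, so the one picked by `semigroup` may be used
without identifying it. -/
lemma isMildSolution_semigroup [CompleteSpace X] (hA : IsMAccretive A ω) (hω : 0 ≤ ω)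
    {x : X} (hx : x ∈ closure (dom A)) : IsMildSolution A x (fun t => semigroup A t x) := by
  have hex := hA.exists_isMildSolution hω hx
  have : (fun t => semigroup A t x) = hex.choose := by
    funext t
    simp only [semigroup, dif_pos hex]
  rw [this]
  exact hex.choose_spec

end Existence

/-! ### The `K`-function controls the modulus of continuity of orbits. -/

section Estimate
variable {X : Type*} [NormedAddCommGroup X] {A : Set (X × X)} {ω : ℝ}

/-- The `K`-function of the couple `(‖·‖, |A ·|)`. -/
abbrev kOp (A : Set (X × X)) (x : X) (t : ℝ) : ℝ≥0∞ := kFun (fun y => ‖y‖ₑ) (setNorm A) x t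

/-- Almost minimizers of the `K`-functional. Since `t > 0`, a finite value forces `|A v|` to be
finite, so `v` lies in the domain. -/
lemma exists_of_kOp_lt {x : X} {t r : ℝ} (ht : 0 < t) (h : kOp A x t < ENNReal.ofReal r) :
    ∃ v b, (v, b) ∈ A ∧ ‖x - v‖ + t * ‖b‖ < r := by
  obtain ⟨v, hv⟩ := iInf_lt_iff.1 h
  change ‖x - v‖ₑ + ENNReal.ofReal t * setNorm A v < _ at hv
  have ht' : ENNReal.ofReal t ≠ 0 := by simpa using ht
  rw [← lt_tsub_iff_left, mul_comm, ← ENNReal.lt_div_iff_mul_lt (.inl ht')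
    (.inl ENNReal.ofReal_ne_top), setNorm] at hv
  obtain ⟨b, hb⟩ := iInf_lt_iff.1 hv
  obtain ⟨hab, hb⟩ := iInf_lt_iff.1 hb
  refine ⟨v, b, hab, ?_⟩
  rw [ENNReal.lt_div_iff_mul_lt (.inl ht') (.inl ENNReal.ofReal_ne_top), mul_comm,
    lt_tsub_iff_left, ← ofReal_norm, ← ofReal_norm, ← ENNReal.ofReal_mul ht.le,
    ← ENNReal.ofReal_add (norm_nonneg _) (by positivity)] at hb
  exact (ENNReal.ofReal_lt_ofReal_iff_of_nonneg (by positivity)).1 hb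

lemma mem_closure_dom_of_kOp_lt {x : X} (h : ∀ r > 0, ∃ t > 0, kOp A x t < ENNReal.ofReal r) :
    x ∈ closure (dom A) := by
  refine Metric.mem_closure_iff.2 fun r hr => ?_
  obtain ⟨t, ht, hK⟩ := h r hr
  obtain ⟨v, b, hab, hlt⟩ := exists_of_kOp_lt ht hK
  refine ⟨v, ⟨b, hab⟩, ?_⟩
  rw [dist_eq_norm]
  have := mul_nonneg ht.le (norm_nonneg b)
  linarith

/-- The function `t ↦ K(x, t) / t` is decreasing. -/
lemma kOp_div_anti (A : Set (X × X)) (x : X) {s t : ℝ} (hs : 0 < s) (hst : s ≤ t) :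
    kOp A x t / ENNReal.ofReal t ≤ kOp A x s / ENNReal.ofReal s := by
  have hs' : ENNReal.ofReal s ≠ 0 := by simpa using hs
  have ht' : ENNReal.ofReal t ≠ 0 := by simpa using hs.trans_le hst
  have hle := ENNReal.ofReal_le_ofReal hst
  rw [ENNReal.le_div_iff_mul_le (.inl hs') (.inl ENNReal.ofReal_ne_top)]
  refine le_iInf fun v => ?_
  refine (mul_le_mul_left (ENNReal.div_le_div_right (iInf_le _ v) _) _).trans ?_
  rw [ENNReal.add_div, add_mul]
  refine add_le_add ?_ (le_of_eq ?_)
  · rw [ENNReal.div_eq_inv_mul, mul_right_comm, mul_comm]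
    refine mul_le_of_le_one_right' ?_
    rw [← ENNReal.div_eq_inv_mul]
    exact ENNReal.div_le_of_le_mul (by simpa using hle)
  · rw [mul_comm (ENNReal.ofReal t), ENNReal.mul_div_cancel_right ht' ENNReal.ofReal_ne_top,
      mul_comm]

lemma kOp_le_ofReal {x : X} {h : ℝ} (hh : 0 < h) {N c : ℝ≥0∞} (hN : N ≠ ∞) (hc : c ≠ 0)
    (hc' : c ≠ ∞) (hK : kOp A x h / ENNReal.ofReal h * c ≤ N) :
    kOp A x h ≤ ENNReal.ofReal (N.toReal * (h / c.toReal)) := by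
  have hh' : ENNReal.ofReal h ≠ 0 := by simpa using hh
  rw [← ENNReal.le_div_iff_mul_le (.inl hc) (.inl hc'),
    ENNReal.div_le_iff hh' ENNReal.ofReal_ne_top] at hK
  refine hK.trans (le_of_eq ?_)
  have hcp : 0 < c.toReal := ENNReal.toReal_pos hc hc'
  rw [← mul_div_assoc, mul_div_right_comm, ENNReal.ofReal_mul (by positivity),
    ENNReal.ofReal_div_of_pos hcp, ENNReal.ofReal_toReal hN, ENNReal.ofReal_toReal hc']

variable [NormedSpace ℝ X] [CompleteSpace X]

/-- The translated orbit starts at `S(h)x` and is compared with the orbit of `x`. Continuous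
dependence asks only one of the two initial values to lie in the closure of the domain, and here
that is `x`. -/
lemma norm_semigroup_add_sub_le (hA : IsMAccretive A ω) (hω : 0 ≤ ω) {x : X}
    (hx : x ∈ closure (dom A)) {t h : ℝ} (ht : 0 ≤ t) (hh : 0 < h) :
    ‖semigroup A (t + h) x - semigroup A t x‖ ≤ Real.exp (ω * t) * ‖semigroup A h x - x‖ := by
  have hu := isMildSolution_semigroup hA hω hx
  have := (hu.translate hh).norm_sub_le hu hx hA hω ht
  rwa [add_comm t h]

lemma norm_semigroup_sub_self_le (hA : IsMAccretive A ω) (hω : 0 ≤ ω) {x : X}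
    (hx : x ∈ closure (dom A)) {h r : ℝ} (hh : 0 < h) (hr : 0 ≤ r)
    (hK : kOp A x h ≤ ENNReal.ofReal r) :
    ‖semigroup A h x - x‖ ≤ (1 + Real.exp (ω * h)) * r := by
  have hu := isMildSolution_semigroup hA hω hx
  -- The infimum defining `K` need not be attained, so the bound is proved for every `r' > r` and
  -- passed to the limit.
  have key : ∀ r' > r, 0 < r' → ‖semigroup A h x - x‖ ≤ (1 + Real.exp (ω * h)) * r' := by
    intro r' hr' hr0
    obtain ⟨v, b, hvb, hlt⟩ := exists_of_kOp_lt hh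
      (hK.trans_lt ((ENNReal.ofReal_lt_ofReal_iff hr0).2 hr'))
    have hv := hu.norm_sub_dom_le hA hω hvb hh.le
    have h1 : ‖semigroup A h x - x‖ ≤ ‖semigroup A h x - v‖ + ‖x - v‖ := by
      have := norm_sub_le (semigroup A h x - v) (x - v)
      rwa [sub_sub_sub_cancel_right] at this
    have h2 := mul_nonneg hh.le (norm_nonneg b)
    have h3 := mul_le_mul_of_nonneg_left hlt.le (Real.exp_pos (ω * h)).le
    linarith
  have hlim : Tendsto (fun r' : ℝ => (1 + Real.exp (ω * h)) * r') (𝓝[>] r)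
      (𝓝 ((1 + Real.exp (ω * h)) * r)) :=
    ((continuous_const.mul continuous_id).tendsto r).mono_left nhdsWithin_le_nhds
  refine ge_of_tendsto hlim ?_
  filter_upwards [self_mem_nhdsWithin] with r' hr'
  exact key r' hr' (hr.trans_lt hr')

/-- The basic estimate, for the value `c` of the norm of the characteristic function of `(0, h)`. -/
lemma norm_semigroup_add_sub_le_of_kOp (hA : IsMAccretive A ω) (hω : 0 ≤ ω) {x : X}
    (hx : x ∈ closure (dom A)) {h τ : ℝ} (hh : h ∈ Ioo 0 τ) {N c : ℝ≥0∞} (hN : N ≠ ∞) (hc : c ≠ 0)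
    (hc' : c ≠ ∞) (hK : kOp A x h / ENNReal.ofReal h * c ≤ N) {t T : ℝ} (ht : t ∈ Icc 0 T) :
    ‖semigroup A (t + h) x - semigroup A t x‖
      ≤ Real.exp (ω * T) * (1 + Real.exp (ω * τ)) * N.toReal * (h / c.toReal) := by
  have hh0 : 0 < h := hh.1
  have hhτ : h ≤ τ := hh.2.le
  have htT : t ≤ T := ht.2
  have h1 := norm_semigroup_sub_self_le hA hω hx hh.1 (by positivity)
    (kOp_le_ofReal hh.1 hN hc hc' hK)
  refine (norm_semigroup_add_sub_le hA hω hx ht.1 hh.1).trans ?_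
  rw [mul_assoc, mul_assoc]
  refine mul_le_mul (Real.exp_le_exp.2 (by gcongr)) (h1.trans ?_) (norm_nonneg _)
    (Real.exp_pos _).le
  gcongr

end Estimate

/-! ### Banach function spaces -/

section FunctionSpaces

lemma memLp_chi (p : ℝ≥0∞) (h : ℝ) :
    MemLp ((Ioo 0 h).indicator fun _ => (1 : ℂ)) p halfLine := by
  refine memLp_indicator_const p measurableSet_Ioo 1 (.inr ?_)
  exact ((Measure.restrict_apply_le _ _).trans_lt measure_Ioo_lt_top).ne

/-- The class of the characteristic function of `(0, h)`, as an element of a Banach function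
space. -/
def BanachFunctionSpace.chiElem (E : BanachFunctionSpace) (h : ℝ) : E.carrier :=
  ⟨AEEqFun.mk _ (memLp_chi 1 h).1,
    E.inf_le ⟨((memLp_chi 1 h).toLp _).2, ((memLp_chi ∞ h).toLp _).2⟩⟩

lemma BanachFunctionSpace.coeFn_chiElem (E : BanachFunctionSpace) (h : ℝ) :
    ((E.chiElem h : E.carrier) : ℝ →ₘ[halfLine] ℂ)
      =ᵐ[halfLine] (Ioo 0 h).indicator fun _ => (1 : ℂ) :=
  AEEqFun.coeFn_mk _ _

lemma exists_mem_Ioo_of_ae {P : ℝ → Prop} (hP : ∀ᵐ t ∂halfLine, P t) {h : ℝ} (hh : 0 < h) :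
    ∃ t ∈ Ioo 0 h, P t := by
  have h1 : ∀ᵐ t ∂volume.restrict (Ioo 0 h), P t :=
    ae_restrict_of_ae_restrict_of_subset Ioo_subset_Ioi_self hP
  have h2 : ∀ᵐ t ∂volume.restrict (Ioo 0 h), t ∈ Ioo 0 h := ae_restrict_mem measurableSet_Ioo
  have : NeBot (ae (volume.restrict (Ioo 0 h))) := by
    rw [ae_restrict_neBot]
    simpa using hh
  exact (h2.and h1).exists

namespace BanachFunctionSpace

variable (E : BanachFunctionSpace)

lemma nrm_chiElem_pos {h : ℝ} (hh : 0 < h) : 0 < E.nrm (E.chiElem h) := by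
  refine (apply_nonneg E.nrm _).lt_of_ne' fun h0 => ?_
  have h1 := E.nrm_definite _ h0
  have h2 := E.coeFn_chiElem h
  rw [h1] at h2
  obtain ⟨t, ht, h3, h4⟩ := exists_mem_Ioo_of_ae
    (h2.and (AEEqFun.coeFn_zero (α := ℝ) (β := ℂ) (μ := halfLine))) hh
  have h5 : ((0 : ℝ →ₘ[halfLine] ℂ)) t = 1 := by
    simpa [indicator_of_mem ht] using h3
  rw [h4] at h5
  simp at h5

lemma eNorm_chi_le (h : ℝ) : E.eNorm (chi h) ≤ ENNReal.ofReal (E.nrm (E.chiElem h)) := by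
  refine iInf₂_le (E.chiElem h) ?_
  filter_upwards [E.coeFn_chiElem h] with t ht
  rw [ht, chi]
  by_cases h : t ∈ Ioo 0 h <;> simp [h]

/-- Every `g` competing in the infimum has modulus `χ_{(0,h)}`, so the ideal property puts the norm
of `chiElem` below that of `g`. -/
lemma le_eNorm_chi (h : ℝ) : ENNReal.ofReal (E.nrm (E.chiElem h)) ≤ E.eNorm (chi h) := by
  refine le_iInf₂ fun g hg => ENNReal.ofReal_le_ofReal ?_
  obtain ⟨_, h1⟩ := E.ideal g (E.chiElem h) (E.le_sup (E.chiElem h).2) (by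
    filter_upwards [hg, E.coeFn_chiElem h] with t h1 h2
    rw [h2, ← toReal_enorm, ← toReal_enorm, h1, chi]
    by_cases h : t ∈ Ioo 0 h <;> simp [h])
  exact h1

variable {X : Type*} [NormedAddCommGroup X] {A : Set (X × X)} {τ : ℝ} {x : X}

/-- Since `K(x, t) / t` decreases, the constant `K(x, h) / h` on `(0, h)` lies below it, and the
norm respects this order by the ideal property. -/
lemma mul_eNorm_chi_le_interpOp {h : ℝ} (hh : h ∈ Ioo 0 τ) :
    kOp A x h / ENNReal.ofReal h * E.eNorm (chi h) ≤ interpOp E.eNorm A τ x := by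
  refine le_iInf₂ fun g hg => ?_
  have hle : ∀ t ∈ Ioo 0 h, kOp A x h / ENNReal.ofReal h
      ≤ (Ioo 0 τ).indicator (fun t => kOp A x t / ENNReal.ofReal t) t := fun t ht => by
    rw [indicator_of_mem (show t ∈ Ioo 0 τ from ⟨ht.1, ht.2.trans hh.2⟩)]
    exact kOp_div_anti A x ht.1 ht.2.le
  -- A competitor `g` has finite values, so the quotient is finite at some `t < h`, and monotonicity
  -- carries this to `h`.
  have hfin : kOp A x h / ENNReal.ofReal h ≠ ∞ := by
    obtain ⟨t, ht, hgt⟩ := exists_mem_Ioo_of_ae hg hh.1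
    exact ((hle t ht).trans_lt (hgt ▸ enorm_lt_top)).ne
  set Q := (kOp A x h / ENNReal.ofReal h).toReal with hQ
  have hQ0 : 0 ≤ Q := ENNReal.toReal_nonneg
  obtain ⟨_, h1⟩ := E.ideal g ((Q : ℂ) • E.chiElem h : E.carrier)
    (E.le_sup ((Q : ℂ) • E.chiElem h : E.carrier).2) (by
      filter_upwards [hg, E.coeFn_chiElem h,
        AEEqFun.coeFn_smul (Q : ℂ) ((E.chiElem h : E.carrier) : ℝ →ₘ[halfLine] ℂ)] with t h1 h2 h3
      have h4 : (((Q : ℂ) • E.chiElem h : E.carrier) : ℝ →ₘ[halfLine] ℂ) t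
          = (Q : ℂ) * (Ioo 0 h).indicator (fun _ => (1 : ℂ)) t := by
        rw [← h2]
        exact h3
      rw [h4]
      by_cases ht : t ∈ Ioo 0 h
      · rw [indicator_of_mem ht, mul_one, Complex.norm_real, Real.norm_of_nonneg hQ0, hQ,
          ← toReal_enorm]
        exact ENNReal.toReal_mono enorm_ne_top (h1 ▸ hle t ht)
      · simp [indicator_of_notMem ht])
  have h2 : Q * E.nrm (E.chiElem h) ≤ E.nrm g := by
    have h3 : E.nrm ((Q : ℂ) • E.chiElem h) ≤ E.nrm g := h1
    rwa [map_smul_eq_mul, Complex.norm_real, Real.norm_of_nonneg hQ0] at h3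
  calc _ ≤ ENNReal.ofReal Q * ENNReal.ofReal (E.nrm (E.chiElem h)) := by
        rw [hQ, ENNReal.ofReal_toReal hfin]
        gcongr
        exact E.eNorm_chi_le h
    _ ≤ _ := by
        rw [← ENNReal.ofReal_mul hQ0]
        exact ENNReal.ofReal_le_ofReal h2

lemma integrableOn_Ioo (g : E.carrier) (τ : ℝ) :
    IntegrableOn (g : ℝ →ₘ[halfLine] ℂ) (Ioo 0 τ) := by
  obtain ⟨g₁, h₁, g₂, h₂, hg⟩ := AddSubgroup.mem_sup.1 (E.le_sup g.2)
  have hle : volume.restrict (Ioo 0 τ) ≤ halfLine :=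
    Measure.restrict_mono Ioo_subset_Ioi_self le_rfl
  have i₁ : Integrable g₁ (volume.restrict (Ioo 0 τ)) :=
    memLp_one_iff_integrable.1 ((Lp.mem_Lp_iff_memLp.1 h₁).mono_measure hle)
  have i₂ : Integrable g₂ (volume.restrict (Ioo 0 τ)) :=
    memLp_one_iff_integrable.1
      (((Lp.mem_Lp_iff_memLp.1 h₂).mono_measure hle).mono_exponent le_top)
  refine (i₁.add i₂).congr ?_
  have h3 := AEEqFun.coeFn_add g₁ g₂
  rw [hg] at h3
  exact EventuallyEq.symm (h3.filter_mono (ae_mono hle))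

/-- If `x` were not in the closure, `K(x, ·)` would be bounded below by some `r > 0`. Then `r / t`
would be dominated on `(0, τ)` by an element of `L¹ + L^∞`, which is integrable there, whereas `1 /
t` is not. -/
lemma mem_closure_dom (hτ : 0 < τ) (h : interpOp E.eNorm A τ x < ∞) : x ∈ closure (dom A) := by
  obtain ⟨g, hg⟩ := iInf_lt_iff.1 h
  obtain ⟨hg, -⟩ := iInf_lt_iff.1 hg
  by_contra hx
  have hK : ∃ r > 0, ∀ t > 0, ENNReal.ofReal r ≤ kOp A x t := by
    by_contra! hK
    exact hx (mem_closure_dom_of_kOp_lt hK)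
  obtain ⟨r, hr, hK⟩ := hK
  have hint : IntegrableOn (fun t : ℝ => t⁻¹) (Ioo 0 τ) := by
    refine ((E.integrableOn_Ioo g τ).norm.const_mul r⁻¹).mono'
      measurable_inv.aestronglyMeasurable ?_
    filter_upwards [ae_restrict_of_ae_restrict_of_subset Ioo_subset_Ioi_self hg,
      ae_restrict_mem measurableSet_Ioo] with t h1 ht
    have ht0 : 0 < t := ht.1
    have h2 : ENNReal.ofReal (r / t) ≤ ‖(g : ℝ →ₘ[halfLine] ℂ) t‖ₑ := by
      rw [h1, indicator_of_mem ht, ENNReal.ofReal_div_of_pos ht.1]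
      exact ENNReal.div_le_div_right (hK t ht.1) _
    rw [← ofReal_norm, ENNReal.ofReal_le_ofReal_iff (norm_nonneg _)] at h2
    rw [Real.norm_of_nonneg (by positivity), ← div_eq_inv_mul, le_div_iff₀ hr]
    rwa [div_eq_inv_mul] at h2
  have hint' : IntervalIntegrable (fun t : ℝ => t⁻¹) volume 0 τ :=
    (intervalIntegrable_iff_integrableOn_Ioo_of_le hτ.le).2 hint
  rcases intervalIntegrable_inv_iff.1 hint' with h0 | h0
  · exact hτ.ne h0
  · exact h0 left_mem_uIcc

end BanachFunctionSpace

/-! ### The weighted spaces -/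

lemma weightedNorm_mono {θ p : ℝ} (hp : 1 ≤ p) {f g : ℝ → ℝ≥0∞} (hfg : ∀ t, f t ≤ g t) :
    weightedNorm θ p f ≤ weightedNorm θ p g := by
  unfold weightedNorm
  have hp0 : 0 ≤ p := by linarith
  gcongr with t
  exact hfg t

lemma weightedNorm_chi {θ p : ℝ} (hθ : θ < 1) (hp : 1 ≤ p) {h : ℝ} (hh : 0 < h) :
    weightedNorm θ p (chi h)
      = ENNReal.ofReal (h ^ (1 - θ) / (p * (1 - θ)) ^ (1 / p)) := by
  have hp0 : 0 < p := by linarith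
  have ha : 0 < p * (1 - θ) := mul_pos hp0 (by linarith)
  have h1 : ∀ t, chi h t ^ p * ENNReal.ofReal (t ^ (p * (1 - θ) - 1))
      = (Ioo 0 h).indicator (fun t => ENNReal.ofReal (t ^ (p * (1 - θ) - 1))) t := by
    intro t
    by_cases ht : t ∈ Ioo 0 h <;> simp [chi, ht, hp0]
  have hint : IntegrableOn (fun t : ℝ => t ^ (p * (1 - θ) - 1)) (Ioo 0 h) :=
    (intervalIntegrable_iff_integrableOn_Ioo_of_le hh.le).1
      (intervalIntegral.intervalIntegrable_rpow' (by linarith))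
  have h2 : ∫⁻ t in Ioi (0 : ℝ), chi h t ^ p * ENNReal.ofReal (t ^ (p * (1 - θ) - 1))
      = ENNReal.ofReal (h ^ (p * (1 - θ)) / (p * (1 - θ))) := by
    simp only [h1]
    rw [lintegral_indicator measurableSet_Ioo, Measure.restrict_restrict measurableSet_Ioo,
      inter_eq_self_of_subset_left Ioo_subset_Ioi_self, ← ofReal_integral_eq_lintegral_ofReal hint,
      ← integral_Ioc_eq_integral_Ioo, ← intervalIntegral.integral_of_le hh.le,
      integral_rpow (.inl (by linarith))]
    · simp [Real.zero_rpow ha.ne']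
    · filter_upwards [ae_restrict_mem measurableSet_Ioo] with t ht
      exact Real.rpow_nonneg ht.1.le _
  rw [weightedNorm, h2, ENNReal.ofReal_rpow_of_pos (by positivity),
    Real.div_rpow (by positivity) ha.le, ← Real.rpow_mul hh.le]
  congr 3
  field_simp

/-- The same monotonicity argument, applied directly to the integral; the quotient `q` may be
infinite. -/
lemma mul_weightedNorm_chi_le_interpOp {X : Type*} [NormedAddCommGroup X] {A : Set (X × X)}
    {τ : ℝ} {x : X} {θ p : ℝ} (hp : 1 ≤ p) {h : ℝ} (hh : h ∈ Ioo 0 τ) :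
    kOp A x h / ENNReal.ofReal h * weightedNorm θ p (chi h)
      ≤ interpOp (weightedNorm θ p) A τ x := by
  have hp0 : 0 < p := by linarith
  set q := kOp A x h / ENNReal.ofReal h with hq
  have h1 : q * weightedNorm θ p (chi h) = weightedNorm θ p (fun t => q * chi h t) := by
    unfold weightedNorm
    simp only [ENNReal.mul_rpow_of_nonneg _ _ hp0.le, mul_assoc]
    rw [lintegral_const_mul, ENNReal.mul_rpow_of_nonneg _ _ (by positivity), ← ENNReal.rpow_mul,
      mul_one_div_cancel hp0.ne', ENNReal.rpow_one]
    have : Measurable (chi h) := measurable_one.indicator measurableSet_Ioo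
    fun_prop
  rw [h1]
  refine weightedNorm_mono hp fun t => ?_
  by_cases ht : t ∈ Ioo 0 h
  · rw [chi, indicator_of_mem ht, indicator_of_mem (show t ∈ Ioo 0 τ from ⟨ht.1, ht.2.trans hh.2⟩),
      Pi.one_apply, mul_one]
    exact kOp_div_anti A x ht.1 ht.2.le
  · simp [chi, ht]

end FunctionSpaces

/-! ### Hölder continuity from the weighted spaces. -/

section Main
variable {X : Type*} [NormedAddCommGroup X] {A : Set (X × X)} {ω : ℝ}

lemma weightedNorm_chi_ne {θ p : ℝ} (hθ : θ < 1) (hp : 1 ≤ p) {h : ℝ} (hh : 0 < h) :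
    weightedNorm θ p (chi h) ≠ 0 ∧ weightedNorm θ p (chi h) ≠ ∞ := by
  have ha : 0 < p * (1 - θ) := mul_pos (by linarith) (by linarith)
  rw [weightedNorm_chi hθ hp hh]
  refine ⟨?_, ENNReal.ofReal_ne_top⟩
  rw [Ne, ENNReal.ofReal_eq_zero, not_le]
  positivity

/-- Source of the exponent `θ`: the norm of `χ_{(0,h)}` scales like `h ^ (1 - θ)`. -/
lemma div_weightedNorm_chi {θ p : ℝ} (hθ : θ < 1) (hp : 1 ≤ p) {h : ℝ} (hh : 0 < h) :
    h / (weightedNorm θ p (chi h)).toReal = (p * (1 - θ)) ^ (1 / p) * h ^ θ := by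
  have ha : 0 < p * (1 - θ) := mul_pos (by linarith) (by linarith)
  rw [weightedNorm_chi hθ hp hh, ENNReal.toReal_ofReal (by positivity)]
  have h1 : h = h ^ θ * h ^ (1 - θ) := by
    rw [← Real.rpow_add hh, add_sub_cancel, Real.rpow_one]
  have h2 : 0 < h ^ (1 - θ) := by positivity
  have h3 : 0 < (p * (1 - θ)) ^ (1 / p) := by positivity
  nth_rewrite 1 [h1]
  field_simp

/-- Here the estimate itself gives `K(x, h) ≤ C h ^ θ`, which tends to `0` with `h`. -/
lemma mem_closure_dom_of_weightedNorm {θ p τ : ℝ} (hθ : θ ∈ Ioo (0 : ℝ) 1) (hp : 1 ≤ p)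
    (hτ : 0 < τ) {x : X} (hx : interpOp (weightedNorm θ p) A τ x < ∞) :
    x ∈ closure (dom A) := by
  refine mem_closure_dom_of_kOp_lt fun r hr => ?_
  set N := (interpOp (weightedNorm θ p) A τ x).toReal
  have hlim : Tendsto (fun h : ℝ => N * ((p * (1 - θ)) ^ (1 / p) * h ^ θ)) (𝓝[>] 0) (𝓝 0) := by
    have hc : ContinuousAt (fun h : ℝ => N * ((p * (1 - θ)) ^ (1 / p) * h ^ θ)) 0 :=
      continuousAt_const.mul (continuousAt_const.mul (Real.continuousAt_rpow_const _ _ (.inr hθ.1.le)))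
    have := hc.tendsto.mono_left (nhdsWithin_le_nhds (s := Ioi 0))
    simpa [Real.zero_rpow hθ.1.ne'] using this
  obtain ⟨h, hlt, hh⟩ := ((hlim.eventually (eventually_lt_nhds hr)).and (Ioo_mem_nhdsGT hτ)).exists
  obtain ⟨hc, hc'⟩ := weightedNorm_chi_ne hθ.2 hp hh.1
  refine ⟨h, hh.1, (kOp_le_ofReal hh.1 hx.ne hc hc' (mul_weightedNorm_chi_le_interpOp hp hh)).trans_lt ?_⟩
  rw [div_weightedNorm_chi hθ.2 hp hh.1]
  exact (ENNReal.ofReal_lt_ofReal_iff hr).2 hlt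

/-- A bounded function which satisfies a Hölder condition for small distances satisfies it for all
distances. -/
lemma exists_holder_of_local {u : ℝ → X} {T τ θ C : ℝ} (hu : ContinuousOn u (Icc 0 T))
    (hτ : 0 < τ) (hθ : 0 < θ)
    (h : ∀ t ∈ Icc 0 T, ∀ h ∈ Ioo 0 τ, ‖u (t + h) - u t‖ ≤ C * h ^ θ) :
    ∃ C' : ℝ, ∀ s ∈ Icc 0 T, ∀ t ∈ Icc 0 T, ‖u t - u s‖ ≤ C' * |t - s| ^ θ := by
  obtain ⟨M, hM⟩ := isCompact_Icc.exists_bound_of_continuousOn hu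
  -- At distances of at least `τ` the trivial bound `2 * M` suffices, because there `(t - s) ^ θ ≥ τ
  -- ^ θ`.
  refine ⟨max C (2 * M / τ ^ θ), ?_⟩
  have key : ∀ s ∈ Icc 0 T, ∀ t ∈ Icc 0 T, s < t →
      ‖u t - u s‖ ≤ max C (2 * M / τ ^ θ) * (t - s) ^ θ := by
    intro s hs t ht hst
    have hd : 0 < t - s := sub_pos.2 hst
    rcases lt_or_ge (t - s) τ with hlt | hge
    · have h1 := h s hs (t - s) ⟨hd, hlt⟩
      rw [add_sub_cancel] at h1
      exact h1.trans (mul_le_mul_of_nonneg_right (le_max_left _ _) (Real.rpow_nonneg hd.le _))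
    · have hM0 : 0 ≤ M := (norm_nonneg _).trans (hM s hs)
      have hτθ : 0 < τ ^ θ := Real.rpow_pos_of_pos hτ _
      calc ‖u t - u s‖ ≤ 2 * M := by
            linarith [norm_sub_le (u t) (u s), hM s hs, hM t ht]
        _ = 2 * M / τ ^ θ * τ ^ θ := by field_simp
        _ ≤ max C (2 * M / τ ^ θ) * (t - s) ^ θ := by
            refine mul_le_mul (le_max_right _ _) (Real.rpow_le_rpow hτ.le hge hθ.le) hτθ.le ?_
            exact le_trans (by positivity) (le_max_right _ _)
  intro s hs t ht
  rcases lt_trichotomy s t with hst | rfl | hst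
  · rw [abs_of_pos (sub_pos.2 hst)]
    exact key s hs t ht hst
  · simp [Real.zero_rpow hθ.ne']
  · rw [norm_sub_rev, abs_sub_comm, abs_of_pos (sub_pos.2 hst)]
    exact key t ht s hs hst

end Main

end HolderSemigroup

end

theorem mainTheorem7 {X : Type*} [NormedAddCommGroup X] [NormedSpace ℝ X] [CompleteSpace X]
    (A : Set (X × X)) (ω : ℝ) (hω : 0 ≤ ω) (hA : HolderSemigroup.IsMAccretive A ω)
    (τ : ℝ) (hτ : 0 < τ) (hτω : τ * ω < 1) :
    -- the orbits of the semigroup that start in the closure of the domain are mild solutions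
    (∀ x ∈ closure (HolderSemigroup.dom A),
      HolderSemigroup.IsMildSolution A x (fun t => HolderSemigroup.semigroup A t x)) ∧
    -- the estimate for a general Banach function space
    (∀ E : HolderSemigroup.BanachFunctionSpace, E.HardyBounded →
      ∀ x : X, HolderSemigroup.interpOp E.eNorm A τ x < ∞ →
        x ∈ closure (HolderSemigroup.dom A) ∧
        ∀ T > 0, ∀ t ∈ Icc 0 T, ∀ h ∈ Ioo 0 τ,
          ‖HolderSemigroup.semigroup A (t + h) x - HolderSemigroup.semigroup A t x‖
            ≤ Real.exp (ω * T) * (1 + Real.exp (ω * τ))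
              * (HolderSemigroup.interpOp E.eNorm A τ x).toReal
              * (h / (E.eNorm (HolderSemigroup.chi h)).toReal)) ∧
    -- the weighted spaces
    (∀ θ ∈ Ioo (0 : ℝ) 1, ∀ p : ℝ, 1 ≤ p →
      ∀ x : X, HolderSemigroup.interpOp (HolderSemigroup.weightedNorm θ p) A τ x < ∞ →
        x ∈ closure (HolderSemigroup.dom A) ∧
        (∀ T > 0, ∀ t ∈ Icc 0 T, ∀ h ∈ Ioo 0 τ,
          ‖HolderSemigroup.semigroup A (t + h) x - HolderSemigroup.semigroup A t x‖
            ≤ Real.exp (ω * T) * (1 + Real.exp (ω * τ))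
              * (HolderSemigroup.interpOp (HolderSemigroup.weightedNorm θ p) A τ x).toReal
              * (h / (HolderSemigroup.weightedNorm θ p (HolderSemigroup.chi h)).toReal)) ∧
        ∀ T > 0, ∃ C : ℝ, ∀ s ∈ Icc 0 T, ∀ t ∈ Icc 0 T,
          ‖HolderSemigroup.semigroup A t x - HolderSemigroup.semigroup A s x‖
            ≤ C * |t - s| ^ θ) := by
  refine ⟨fun x hx => HolderSemigroup.isMildSolution_semigroup hA hω hx, ?_, ?_⟩
  · intro E _ x hx
    have hcl := E.mem_closure_dom hτ hx
    refine ⟨hcl, fun T _ t ht h hh => ?_⟩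
    refine HolderSemigroup.norm_semigroup_add_sub_le_of_kOp hA hω hcl hh hx.ne ?_ ?_
      (E.mul_eNorm_chi_le_interpOp hh) ht
    · refine ((ENNReal.ofReal_pos.2 (E.nrm_chiElem_pos hh.1)).trans_le (E.le_eNorm_chi h)).ne'
    · exact ((E.eNorm_chi_le h).trans_lt ENNReal.ofReal_lt_top).ne
  · intro θ hθ p hp x hx
    have hcl := HolderSemigroup.mem_closure_dom_of_weightedNorm hθ hp hτ hx
    have hest : ∀ T > 0, ∀ t ∈ Icc 0 T, ∀ h ∈ Ioo 0 τ,
        ‖HolderSemigroup.semigroup A (t + h) x - HolderSemigroup.semigroup A t x‖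
          ≤ Real.exp (ω * T) * (1 + Real.exp (ω * τ))
            * (HolderSemigroup.interpOp (HolderSemigroup.weightedNorm θ p) A τ x).toReal
            * (h / (HolderSemigroup.weightedNorm θ p (HolderSemigroup.chi h)).toReal) := by
      intro T _ t ht h hh
      obtain ⟨hc, hc'⟩ := HolderSemigroup.weightedNorm_chi_ne hθ.2 hp hh.1
      exact HolderSemigroup.norm_semigroup_add_sub_le_of_kOp hA hω hcl hh hx.ne hc hc'
        (HolderSemigroup.mul_weightedNorm_chi_le_interpOp hp hh) ht
    refine ⟨hcl, hest, fun T hT => ?_⟩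
    have hmild := HolderSemigroup.isMildSolution_semigroup hA hω hcl
    refine HolderSemigroup.exists_holder_of_local (hmild.continuousOn.mono fun t ht => ht.1) hτ hθ.1
      (C := Real.exp (ω * T) * (1 + Real.exp (ω * τ))
        * (HolderSemigroup.interpOp (HolderSemigroup.weightedNorm θ p) A τ x).toReal
        * (p * (1 - θ)) ^ (1 / p)) fun t ht h hh => ?_
    have := hest T hT t ht h hh
    rwa [HolderSemigroup.div_weightedNorm_chi hθ.2 hp hh.1, ← mul_assoc] at this
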